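/- Let $p,m\ge 1$ and $d\ge 0$ be integers. A $p\times m$ Finite Impulse Response (FIR) function is a $p\times m$ matrix $F(z)$ of complex Laurent polynomials in $z$. Write $F=F_l+D+F_r$, where $F_l$ collects the positive powers of $z$, $D$ is constant and $F_r$ collects the negative powers. $F$ is causal if $F_l=0$. The McMillan degree of a causal $F$ is the smallest $\nu$ such that $F(z)=C(zI_\nu-A)^{-1}B+D$ for some constant matrices $A\in\mathbb C^{\nu\times\nu},B,C,D$; in general it is the sum of the McMillan degrees of the causal functions $F_r(z)+D$ and $F_l(1/z)$. $F$ is in $\mathcal U$ if for all $|z|=1$ one has $F(z)^*F(z)=I_m$ when $p\ge m$, and $F(z)F(z)^*=I_p$ when $m\ge p$. It is lossless if it is in $\mathcal U$ and all its poles (infinity included) lie in the open unit disk. A trigonometric polynomial in the angles $\theta=(\theta_1,\dots,\theta_N)$ is a complex polynomial in $\cos\theta_i,\sin\theta_i$. (I) Let $p\ge m$ and $N=(2p-m-1)(m+d)+d(m-1)+m$. There are $v_1,\dots,v_d:\mathbb R^N\to\mathbb C^p$ and $U:\mathbb R^N\to\mathbb C^{p\times m}$, with trigonometric polynomials as entries,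 such that $v_j(\theta)^*v_j(\theta)=1$ and $U(\theta)^*U(\theta)=I_m$ for all $\theta$, and such that the $d+1$ maps $$\Phi_\gamma(\theta)(z)=\prod_{j=1}^{\gamma}\bigl(I_p+(z-1)v_j(\theta)v_j(\theta)^*\bigr)\prod_{j=\gamma+1}^{d}\bigl(I_p+(z^{-1}-1)v_j(\theta)v_j(\theta)^*\bigr)\,U(\theta),\qquad \gamma=0,\dots,d,$$ parametrize the $p\times m$ FIRs of McMillan degree $d$ in $\mathcal U$ by $d+1$ copies of the cube $[0,2\pi)^N$, in the following sense: (a) every $\Phi_\gamma(\theta)$, $\theta\in\mathbb R^N$, is a FIR in $\mathcal U$ of McMillan degree at most $d$, and every $p\times m$ FIR in $\mathcal U$ of McMillan degree $d$ equals $\Phi_\gamma(\theta)$ for some $\gamma\in\{0,\dots,d\}$ and $\theta\in[0,2\pi)^N$; (b) the causal ones are parametrized by the single copy $\gamma=0$: every $\Phi_0(\theta)$ is causal, and every causal $p\times m$ FIR in $\mathcal U$ of McMillan degree $d$ equals $\Phi_0(\theta)$ for some $\theta\in[0,2\pi)^N$. If $p=m$, then every $\Phi_0(\theta)$ has McMillan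 degree exactly $d$. (II) Let $m\ge p$ and $N=(2m-p-1)(p+d)+d(p-1)+p$. The same holds with $v_j:\mathbb R^N\to\mathbb C^m$, $U:\mathbb R^N\to\mathbb C^{p\times m}$, $v_j^*v_j=1$, $UU^*=I_p$, and $$\Phi_\gamma(\theta)(z)=U(\theta)\prod_{j=\gamma+1}^{d}\bigl(I_m+(z^{-1}-1)v_j(\theta)v_j(\theta)^*\bigr)\prod_{j=1}^{\gamma}\bigl(I_m+(z-1)v_j(\theta)v_j(\theta)^*\bigr).$$ (III) A $p\times m$ FIR in $\mathcal U$ is causal if and only if it is lossless. (IV) For every $N$ the cube $[0,2\pi)^N$ is convex, and its closure is a polytope (the convex hull of a finite set). -/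

import Mathlib

open scoped LaurentPolynomial Matrix

noncomputable section

/-- A `p × m`-valued Finite Impulse Response function, i.e. a `p × m` matrix of Laurent
polynomials in `z` with complex coefficients (the variable `z` is `LaurentPolynomial.T 1`). -/
abbrev FIR (p m : ℕ) := Matrix (Fin p) (Fin m) ℂ[T;T⁻¹]

namespace FIR

variable {p m : ℕ}

/-- The value `f(z) = ∑ k, a_k z ^ k` of a Laurent polynomial at a point `z ≠ 0`. -/
def evalScalar (f : ℂ[T;T⁻¹]) (z : ℂ) : ℂ := f.coeff.sum fun k a => a * z ^ k

/-- The matrix `F(z)`. -/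
def eval (F : FIR p m) (z : ℂ) : Matrix (Fin p) (Fin m) ℂ := F.map fun f => evalScalar f z

/-- The class `𝒰`: isometric on the unit circle when `p ≥ m`, co-isometric when `m ≥ p`
(for `p = m` the two requirements are equivalent). -/
def InU (F : FIR p m) : Prop :=
  (m ≤ p → ∀ z : ℂ, ‖z‖ = 1 → (F.eval z)ᴴ * F.eval z = 1) ∧
    (p ≤ m → ∀ z : ℂ, ‖z‖ = 1 → F.eval z * (F.eval z)ᴴ = 1)

/-- `F` is causal: no positive power of `z` occurs. -/
def IsCausal (F : FIR p m) : Prop := ∀ i j, ∀ k : ℤ, 0 < k → (F i j).coeff k = 0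

/-- `F` has a pole at the point `a` of the complex plane. -/
def HasPoleAt (F : FIR p m) (a : ℂ) : Prop :=
  ∃ i j, meromorphicOrderAt (fun z => F.eval z i j) a < 0

/-- `F` has a pole at infinity. -/
def HasPoleAtInfty (F : FIR p m) : Prop :=
  ∃ i j, meromorphicOrderAt (fun w => F.eval w⁻¹ i j) 0 < 0

/-- `F` is lossless: it is in `𝒰` and all its poles (in the extended plane) lie in the open
unit disk. -/
def IsLossless (F : FIR p m) : Prop :=
  F.InU ∧ (∀ a : ℂ, F.HasPoleAt a → ‖a‖ < 1) ∧ ¬ F.HasPoleAtInfty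

/-- The part `F_r(z) + D` of `F` made of the powers `z ^ k` with `k ≤ 0`. -/
def causalPart (F : FIR p m) : FIR p m :=
  F.map fun f => AddMonoidAlgebra.ofCoeff (f.coeff.filter fun k => k ≤ 0)

/-- The part `F_l(z)` of `F` made of the powers `z ^ k` with `k > 0`. -/
def strictlyAnticausalPart (F : FIR p m) : FIR p m :=
  F.map fun f => AddMonoidAlgebra.ofCoeff (f.coeff.filter fun k => 0 < k)

/-- The function `F(1/z)`. -/
def reflect (F : FIR p m) : FIR p m := F.map fun f => LaurentPolynomial.invert f

/-- `F(z) = C (z I - A)⁻¹ B + D` for some `A` of size `ν × ν` (and some `B`, `C`, `D`). -/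
def HasRealization (F : FIR p m) (ν : ℕ) : Prop :=
  ∃ (A : Matrix (Fin ν) (Fin ν) ℂ) (B : Matrix (Fin ν) (Fin m) ℂ)
    (C : Matrix (Fin p) (Fin ν) ℂ) (D : Matrix (Fin p) (Fin m) ℂ),
    ∀ z : ℂ, z ≠ 0 → IsUnit (z • (1 : Matrix (Fin ν) (Fin ν) ℂ) - A) →
      F.eval z = C * (z • (1 : Matrix (Fin ν) (Fin ν) ℂ) - A)⁻¹ * B + D

/-- The smallest size of a realization (of a causal `F`; only causal `F` have one). -/
def minRealizationSize (F : FIR p m) : ℕ := sInf {ν | F.HasRealization ν}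

/-- The McMillan degree of `F = F_l + D + F_r`: the size of a minimal realization of the causal
function `F_r(z) + D` plus that of a minimal realization around infinity of `F_l(z)`, i.e. of
the causal function `F_l(1/z)`. -/
def mcMillanDegree (F : FIR p m) : ℕ :=
  F.causalPart.minRealizationSize + F.strictlyAnticausalPart.reflect.minRealizationSize

/-- A constant matrix as a FIR. -/
def const (U : Matrix (Fin p) (Fin m) ℂ) : FIR p m := U.map LaurentPolynomial.C

/-- The elementary factor `I + (b(z) - 1) v v*`, for `b(z) = z` or `b(z) = 1/z`. -/
def factor (b : ℂ[T;T⁻¹]) (v : Fin p → ℂ) : FIR p p :=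
  1 + (b - 1) • const (Matrix.vecMulVec v (star v))

/-- The ordered product `∏_{j=1}^{γ} (I + (z - 1) v_j v_j*)` (`j` is counted from `0` here). -/
def anticausalProd {d : ℕ} (γ : Fin (d + 1)) (v : Fin d → Fin p → ℂ) : FIR p p :=
  (((List.finRange d).filter fun j : Fin d => (j : ℕ) < (γ : ℕ)).map
    fun j => factor (LaurentPolynomial.T 1) (v j)).prod

/-- The ordered product `∏_{j=γ+1}^{d} (I + (1/z - 1) v_j v_j*)` (`j` is counted from `0`
here). -/
def causalProd {d : ℕ} (γ : Fin (d + 1)) (v : Fin d → Fin p → ℂ) : FIR p p :=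
  (((List.finRange d).filter fun j : Fin d => (γ : ℕ) ≤ (j : ℕ)).map
    fun j => factor (LaurentPolynomial.T (-1)) (v j)).prod

/-- `∏_{j ≤ γ} (I_p + (z - 1) v_j v_j*) ∏_{j > γ} (I_p + (1/z - 1) v_j v_j*) U`. -/
def isoProduct {d : ℕ} (γ : Fin (d + 1)) (v : Fin d → Fin p → ℂ)
    (U : Matrix (Fin p) (Fin m) ℂ) : FIR p m :=
  anticausalProd γ v * causalProd γ v * const U

/-- `U ∏_{j > γ} (I_m + (1/z - 1) v_j v_j*) ∏_{j ≤ γ} (I_m + (z - 1) v_j v_j*)`. -/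
def coisoProduct {d : ℕ} (γ : Fin (d + 1)) (v : Fin d → Fin m → ℂ)
    (U : Matrix (Fin p) (Fin m) ℂ) : FIR p m :=
  const U * causalProd γ v * anticausalProd γ v

/-- The number `(2p - m - 1)(m + d) + d(m - 1) + m` of angles; it is used for `p ≥ m ≥ 1` only,
where no subtraction is truncated. -/
def numAngles (p m d : ℕ) : ℕ := (2 * p - m - 1) * (m + d) + d * (m - 1) + m

/-- The cube of angles `[0, 2π)^N`. -/
def angleCube (N : ℕ) : Set (Fin N → ℝ) := {θ | ∀ i, θ i ∈ Set.Ico 0 (2 * Real.pi)}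

/-- Trigonometric polynomials in `N` angles: complex polynomials in the functions
`cos θ_i` and `sin θ_i`. -/
def IsTrigPoly {N : ℕ} (f : (Fin N → ℝ) → ℂ) : Prop :=
  f ∈ Algebra.adjoin ℂ
    ((Set.range fun (i : Fin N) (θ : Fin N → ℝ) => (Real.cos (θ i) : ℂ)) ∪
      Set.range fun (i : Fin N) (θ : Fin N → ℝ) => (Real.sin (θ i) : ℂ))

/-- The maps `Φ 0, …, Φ d` parametrize the `p × m` FIRs of McMillan degree `d` in `𝒰` by `d + 1`
copies of the cube `[0, 2π)^N`, and `Φ 0` alone parametrizes the causal ones. -/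
def IsParametrization {d N : ℕ} (Φ : Fin (d + 1) → (Fin N → ℝ) → FIR p m) : Prop :=
  (∀ γ θ, (Φ γ θ).InU ∧ (Φ γ θ).mcMillanDegree ≤ d) ∧
  (∀ F : FIR p m, F.InU → F.mcMillanDegree = d → ∃ γ, ∃ θ ∈ angleCube N, Φ γ θ = F) ∧
  (∀ θ, (Φ 0 θ).IsCausal) ∧
  (∀ F : FIR p m, F.InU → F.mcMillanDegree = d → F.IsCausal → ∃ θ ∈ angleCube N, Φ 0 θ = F) ∧
  (p = m → ∀ θ, (Φ 0 θ).mcMillanDegree = d)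

end FIR

end

/-!
An FIR `F` with `F♯ F = 1`, where `F♯(z) = F(1 / conj z)ᴴ`, is factored by means of its two Hankel
operators. The Hankel space of `F` (`hankelSpace`) consists of the strictly negative parts of the
vectors `F q`, `q` a polynomial vector; its dimension (`hankelRank`) is the least size of a
realization of the causal part of `F`. A realization factors the Hankel operator through its state
space, and conversely the shift on the Hankel space realizes a causal `F`
(`minRealizationSize_eq_hankelRank`). So the McMillan degree of `F` is the sum of the Hankel ranks
of `F(z)` and `F(1/z)` (`mcMillanDegree_eq`). A factor `I + (1/z - 1) v v*` raises the first rank by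
at most one and `I + (z - 1) v v*` does not raise it, which bounds the degree of the products
(`mcMillanDegree_listProduct_le`).

Conversely, a nonzero Hankel space is stable under a nilpotent shift, hence contains some `v / z`
with `v` a unit vector (`exists_mono_mem_hankelSpace`). Write `F = (I + (1/z - 1) v v*) F₁`. The
Hankel rank of `F₁` is smaller than that of `F`, as `v / z` has been sent to zero
(`hankelRank_factor_mul_lt`). The Hankel rank of `F₁(1/z)` is not larger than that of `F(1/z)`; this
is where isometry enters (`hankelRank_reflect_factor_mul_le`). Peeling off factors first on the
anticausal and then on the causal side exhausts both ranks and leaves a constant isometry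
(`exists_eq_listProduct`). As the degree of the product is at most the number of its factors, that
number is exactly the degree of `F`. In the square case the determinant counts the factors of a
causal product, so that its degree is exactly their number (`hankelRank_listProduct_nil`).

A factor depends on `v` only up to a phase. Unit vectors of `ℂ ^ p` up to a phase are first columns
of unitary matrices depending trigonometrically on `2 p - 2` angles: plane rotations reduce `p` to
`p - 1` (`exists_unitary_family_phase`). The same matrices peel the columns off an isometry
(`exists_isometry_family`), which takes `2 p m - m ^ 2` angles. The co-isometric case follows by
transposition, the number of factors of each kind, but not their order, being preserved.
-/

noncomputable section

namespace FIR

open LaurentPolynomial (T C)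

variable {p m n : ℕ}

/-! ### Evaluation and para-conjugation of scalar Laurent polynomials -/

@[simp] lemma evalScalar_add (f g : ℂ[T;T⁻¹]) (z : ℂ) :
    evalScalar (f + g) z = evalScalar f z + evalScalar g z := by
  simp [evalScalar, Finsupp.sum_add_index', add_mul]

@[simp] lemma evalScalar_C_mul_T (a : ℂ) (k : ℤ) (z : ℂ) :
    evalScalar (C a * T k) z = a * z ^ k := by
  rw [← LaurentPolynomial.single_eq_C_mul_T]
  simp [evalScalar, -LaurentPolynomial.single_eq_C_mul_T]

lemma evalScalar_eq_eval₂ (f : ℂ[T;T⁻¹]) {z : ℂ} (hz : z ≠ 0) :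
    evalScalar f z = LaurentPolynomial.eval₂ (RingHom.id ℂ) (Units.mk0 z hz) f := by
  induction f using LaurentPolynomial.induction_on' with
  | add f g hf hg => simp [hf, hg]
  | C_mul_T k a => simp

lemma evalScalar_eq_sum (f : ℂ[T;T⁻¹]) {s : Finset ℤ} (hs : ∀ k ∉ s, f.coeff k = 0) (z : ℂ) :
    evalScalar f z = ∑ k ∈ s, f.coeff k * z ^ k := by
  refine Finsupp.sum_of_support_subset _ (fun k hk => ?_) _ (by simp)
  by_contra h
  exact Finsupp.mem_support_iff.1 hk (hs k h)

/-- A Laurent polynomial is determined by its values on the unit circle. -/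
lemma eq_zero_of_evalScalar_circle {f : ℂ[T;T⁻¹]}
    (h : ∀ z : ℂ, ‖z‖ = 1 → evalScalar f z = 0) : f = 0 := by
  obtain ⟨n, g, hg⟩ := f.exists_T_pow
  have hinf : (Metric.sphere (0 : ℂ) 1).Infinite := by
    refine (isPreconnected_sphere (by simp) 0 1).infinite_of_nontrivial
      ⟨1, by simp, -1, by simp, ?_⟩
    norm_num
  have hg0 : g = 0 := by
    refine g.eq_zero_of_infinite_isRoot (hinf.mono fun z hz => ?_)
    have hz1 : ‖z‖ = 1 := by simpa using hz
    have hz0 : z ≠ 0 := by rintro rfl; simp at hz1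
    have h1 := congrArg (LaurentPolynomial.eval₂ (RingHom.id ℂ) (Units.mk0 z hz0)) hg
    rw [map_mul, ← evalScalar_eq_eval₂ f hz0, h z hz1, zero_mul] at h1
    simpa [Polynomial.IsRoot, Polynomial.eval₂_eq_eval_map] using h1
  have : f * T n = 0 := by rw [← hg, hg0, map_zero]
  have h2 := congrArg (· * T (-n : ℤ)) this
  simpa using h2

/-- Para-conjugation `f ↦ f♯`, `f♯(z) = conj (f (1 / conj z))`; on the unit circle it is complex
conjugation of the values. -/
def parConj : ℂ[T;T⁻¹] →+* ℂ[T;T⁻¹] :=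
  (AddMonoidAlgebra.mapRingHom ℤ (starRingEnd ℂ)).comp
    (LaurentPolynomial.invert (R := ℂ)).toAlgHom.toRingHom

@[simp] lemma coeff_parConj (f : ℂ[T;T⁻¹]) (k : ℤ) :
    (parConj f).coeff k = star (f.coeff (-k)) := by
  simp [parConj]

@[simp] lemma parConj_T (k : ℤ) : parConj (T k) = T (-k) := by
  ext j
  have h : k = -j ↔ -k = j := by omega
  by_cases hj : -k = j <;> simp [h, hj]

@[simp] lemma parConj_C (a : ℂ) : parConj (C a) = C (star a) := by
  ext j
  by_cases hj : j = 0 <;> simp [hj]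

lemma evalScalar_parConj (f : ℂ[T;T⁻¹]) {z : ℂ} (hz : ‖z‖ = 1) :
    evalScalar (parConj f) z = star (evalScalar f z) := by
  induction f using LaurentPolynomial.induction_on' with
  | add f g hf hg => simp [hf, hg]
  | C_mul_T k a =>
    have h : z⁻¹ = (starRingEnd ℂ) z := by
      rw [Complex.inv_def, Complex.normSq_eq_norm_sq, hz]; simp
    rw [map_mul, parConj_C, parConj_T, evalScalar_C_mul_T, evalScalar_C_mul_T, zpow_neg,
      ← inv_zpow, h]
    simp

lemma evalScalar_mul (f g : ℂ[T;T⁻¹]) {z : ℂ} (hz : z ≠ 0) :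
    evalScalar (f * g) z = evalScalar f z * evalScalar g z := by
  simp [evalScalar_eq_eval₂ _ hz]

lemma evalScalar_sum {ι : Type*} (s : Finset ι) (f : ι → ℂ[T;T⁻¹]) {z : ℂ} (hz : z ≠ 0) :
    evalScalar (∑ i ∈ s, f i) z = ∑ i ∈ s, evalScalar (f i) z := by
  simp [evalScalar_eq_eval₂ _ hz]

@[simp] lemma coeff_T_mul (f : ℂ[T;T⁻¹]) (j k : ℤ) : (T j * f).coeff k = f.coeff (k - j) := by
  induction f using LaurentPolynomial.induction_on' with
  | add f g hf hg => rw [mul_add]; simp only [AddMonoidAlgebra.coeff_add, Finsupp.add_apply, hf, hg]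
  | C_mul_T n a =>
    rw [mul_left_comm, ← LaurentPolynomial.T_add, ← LaurentPolynomial.smul_eq_C_mul,
      ← LaurentPolynomial.smul_eq_C_mul]
    have : j + n = k ↔ n = k - j := by omega
    simp [this]

@[simp] lemma coeff_mul_T (f : ℂ[T;T⁻¹]) (j k : ℤ) : (f * T j).coeff k = f.coeff (k - j) := by
  rw [mul_comm, coeff_T_mul]

@[simp] lemma coeff_C_mul (f : ℂ[T;T⁻¹]) (a : ℂ) (k : ℤ) :
    (C a * f).coeff k = a * f.coeff k := by
  rw [← LaurentPolynomial.smul_eq_C_mul]; simp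

@[simp] lemma coeff_mul_C (f : ℂ[T;T⁻¹]) (a : ℂ) (k : ℤ) :
    (f * C a).coeff k = f.coeff k * a := by
  rw [mul_comm, coeff_C_mul, mul_comm]

/-! ### Evaluation and para-adjoint of matrices -/

lemma eval_mul (F : FIR p m) (G : FIR m n) {z : ℂ} (hz : z ≠ 0) :
    eval (F * G) z = eval F z * eval G z := by
  ext i j
  simp [eval, Matrix.mul_apply, evalScalar_sum _ _ hz, evalScalar_mul _ _ hz]

/-- The para-adjoint `F♯(z) = F(1 / conj z)ᴴ`. -/
def adj (F : FIR p m) : FIR m p := (F.map parConj)ᵀ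

@[simp] lemma adj_apply (F : FIR p m) (i : Fin m) (j : Fin p) : adj F i j = parConj (F j i) := rfl

@[simp] lemma adj_mul (F : FIR p m) (G : FIR m n) : adj (F * G) = adj G * adj F := by
  simp [adj, Matrix.map_mul, Matrix.transpose_mul]

@[simp] lemma adj_const (U : Matrix (Fin p) (Fin m) ℂ) : adj (const U) = const Uᴴ := by
  ext1 i j; simp [const]

lemma eval_adj (F : FIR p m) {z : ℂ} (hz : ‖z‖ = 1) : (adj F).eval z = (F.eval z)ᴴ := by
  ext i j; simp [eval, evalScalar_parConj _ hz]

lemma eval_one {z : ℂ} (hz : z ≠ 0) : eval (1 : FIR p p) z = 1 := by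
  ext i j
  by_cases h : i = j <;> simp [eval, evalScalar_eq_eval₂ _ hz, h, Matrix.one_apply]

lemma const_mul (U : Matrix (Fin p) (Fin m) ℂ) (V : Matrix (Fin m) (Fin n) ℂ) :
    const (U * V) = const U * const V := by
  simp [const, Matrix.map_mul]

@[simp] lemma const_one : const (1 : Matrix (Fin p) (Fin p) ℂ) = 1 := by
  simp [const]

lemma const_injective : Function.Injective (const : Matrix (Fin p) (Fin m) ℂ → FIR p m) := by
  intro U V h
  ext i j
  have := congrArg (fun F : FIR p m => (F i j).coeff 0) h
  simpa [const] using this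

/-- Isometry on the unit circle is a polynomial identity. -/
lemma adj_mul_self_iff (F : FIR p m) :
    adj F * F = 1 ↔ ∀ z : ℂ, ‖z‖ = 1 → (F.eval z)ᴴ * F.eval z = 1 := by
  have hz0 : ∀ {z : ℂ}, ‖z‖ = 1 → z ≠ 0 := by rintro z hz rfl; simp at hz
  constructor
  · intro h z hz
    rw [← eval_adj F hz, ← eval_mul _ _ (hz0 hz), h, eval_one (hz0 hz)]
  · intro h
    ext1 i j
    rw [← sub_eq_zero]
    apply eq_zero_of_evalScalar_circle
    intro z hz
    have h1 := h z hz
    rw [← eval_adj F hz, ← eval_mul _ _ (hz0 hz), ← eval_one (hz0 hz)] at h1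
    have h2 := congrFun (congrFun h1 i) j
    simp only [eval, Matrix.map_apply] at h2
    rw [evalScalar_eq_eval₂ _ (hz0 hz)] at h2 ⊢
    rw [evalScalar_eq_eval₂ _ (hz0 hz)] at h2
    rw [map_sub, h2, sub_self]

lemma factor_apply (b : ℂ[T;T⁻¹]) (v : Fin p → ℂ) (i j : Fin p) :
    factor b v i j = (1 : FIR p p) i j + (b - 1) * (C (v i) * C (star (v j))) := by
  simp [factor, const, Matrix.vecMulVec_apply]

lemma adj_factor (b : ℂ[T;T⁻¹]) (v : Fin p → ℂ) : adj (factor b v) = factor (parConj b) v := by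
  ext1 i j
  rw [adj_apply, factor_apply, factor_apply]
  by_cases h : i = j
  · subst h; simp [mul_comm]
  · simp [h, Ne.symm h, mul_comm]

lemma vecMulVec_star_mul_self {v : Fin p → ℂ} (hv : star v ⬝ᵥ v = 1) :
    Matrix.vecMulVec v (star v) * Matrix.vecMulVec v (star v) = Matrix.vecMulVec v (star v) := by
  rw [Matrix.vecMulVec_mul_vecMulVec, hv, one_smul]

lemma factor_mul_factor (b c : ℂ[T;T⁻¹]) {v : Fin p → ℂ} (hv : star v ⬝ᵥ v = 1) :
    factor b v * factor c v = factor (b * c) v := by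
  have h : const (Matrix.vecMulVec v (star v)) * const (Matrix.vecMulVec v (star v)) =
      const (Matrix.vecMulVec v (star v)) := by
    rw [← const_mul, vecMulVec_star_mul_self hv]
  simp only [factor, add_mul, mul_add, one_mul, mul_one, Matrix.smul_mul, Matrix.mul_smul, h,
    smul_smul]
  rw [add_assoc, ← add_smul, ← add_smul]
  congr 2
  ring

@[simp] lemma factor_one (v : Fin p → ℂ) : factor 1 v = 1 := by simp [factor]

lemma adj_factor_mul_self (k : ℤ) {v : Fin p → ℂ} (hv : star v ⬝ᵥ v = 1) :
    adj (factor (T k) v) * factor (T k) v = 1 := by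
  rw [adj_factor, factor_mul_factor _ _ hv, parConj_T, ← LaurentPolynomial.T_add]
  simp

lemma factor_mul_self_neg (k : ℤ) {v : Fin p → ℂ} (hv : star v ⬝ᵥ v = 1) :
    factor (T k) v * factor (T (-k)) v = 1 := by
  rw [factor_mul_factor _ _ hv, ← LaurentPolynomial.T_add]
  simp

lemma factor_smul (b : ℂ[T;T⁻¹]) {c : ℂ} (hc : ‖c‖ = 1) (v : Fin p → ℂ) :
    factor b (c • v) = factor b v := by
  have h : c * star c = 1 := by
    rw [Complex.star_def, Complex.mul_conj, Complex.normSq_eq_norm_sq, hc]; simp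
  have : Matrix.vecMulVec (c • v) (star (c • v)) = Matrix.vecMulVec v (star v) := by
    ext i j
    simp only [Matrix.vecMulVec_apply, Pi.smul_apply, Pi.star_apply, smul_eq_mul, star_mul']
    linear_combination v i * star (v j) * h
  rw [factor, this, factor]

lemma factor_transpose (b : ℂ[T;T⁻¹]) (v : Fin p → ℂ) :
    (factor b v)ᵀ = factor b (star v) := by
  ext1 i j
  rw [Matrix.transpose_apply, factor_apply, factor_apply]
  by_cases h : i = j
  · subst h; simp [mul_comm]
  · simp [h, Ne.symm h, mul_comm]

lemma reflect_mul (F : FIR p m) (G : FIR m n) : reflect (F * G) = reflect F * reflect G := by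
  ext1 i j
  simp [reflect, Matrix.mul_apply]

@[simp] lemma reflect_reflect (F : FIR p m) : reflect (reflect F) = F := by
  ext i j; simp [reflect]

@[simp] lemma reflect_const (U : Matrix (Fin p) (Fin m) ℂ) : reflect (const U) = const U := by
  ext1 i j; simp [reflect, const]

@[simp] lemma reflect_one : reflect (1 : FIR p p) = 1 := by
  rw [← const_one, reflect_const]

lemma reflect_factor (b : ℂ[T;T⁻¹]) (v : Fin p → ℂ) :
    reflect (factor b v) = factor (LaurentPolynomial.invert b) v := by
  ext1 i j
  rw [factor_apply]
  by_cases h : i = j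
  · subst h; simp [reflect, factor_apply]
  · simp [reflect, factor_apply, h]

lemma adj_reflect (F : FIR p m) : adj (reflect F) = reflect (adj F) := by
  ext i j; simp [reflect]

lemma adj_reflect_mul_self {F : FIR p m} (h : adj F * F = 1) :
    adj (reflect F) * reflect F = 1 := by
  rw [adj_reflect, ← reflect_mul, h, reflect_one]

lemma det_factor (b : ℂ[T;T⁻¹]) {v : Fin p → ℂ} (hv : star v ⬝ᵥ v = 1) :
    (factor b v).det = b := by
  have h : factor b v = 1 + Matrix.replicateCol Unit (fun i => (b - 1) * C (v i)) *
      Matrix.replicateRow Unit (fun i => C (star (v i))) := by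
    ext1 i j
    rw [factor_apply]
    simp [Matrix.mul_apply, mul_assoc]
  rw [h, Matrix.det_one_add_replicateCol_mul_replicateRow]
  have h2 : (fun i => C (star (v i))) ⬝ᵥ (fun i => (b - 1) * C (v i)) =
      (b - 1) * C (star v ⬝ᵥ v) := by
    simp only [dotProduct, map_sum, Finset.mul_sum, map_mul, Pi.star_apply]
    exact Finset.sum_congr rfl fun i _ => by ring
  rw [h2, hv]; simp

/-! ### Hankel spaces -/

/-- The vectors of Laurent polynomials all of whose exponents lie in `s`. -/
def supp (p : ℕ) (s : Set ℤ) : Submodule ℂ (Fin p → ℂ[T;T⁻¹]) where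
  carrier := {f | ∀ i, ∀ k ∉ s, (f i).coeff k = 0}
  zero_mem' := by simp
  add_mem' := by
    intro f g hf hg i k hk
    simp [hf i k hk, hg i k hk]
  smul_mem' := by
    intro c f hf i k hk
    simp [hf i k hk]

open Pointwise in
lemma coeff_mul_eq_zero {s t : Set ℤ} {f g : ℂ[T;T⁻¹]} (hf : ∀ k ∉ s, f.coeff k = 0)
    (hg : ∀ k ∉ t, g.coeff k = 0) {k : ℤ} (hk : k ∉ s + t) : (f * g).coeff k = 0 := by
  rw [AddMonoidAlgebra.coeff_mul]
  refine Finset.sum_eq_zero fun a ha => Finset.sum_eq_zero fun b hb => ?_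
  have ha' : a ∈ s := by
    by_contra h; exact Finsupp.mem_support_iff.1 ha (hf a h)
  have hb' : b ∈ t := by
    by_contra h; exact Finsupp.mem_support_iff.1 hb (hg b h)
  refine if_neg fun h => hk ?_
  rw [← h]
  exact Set.add_mem_add ha' hb'

/-- All exponents occurring in the matrix `F` lie in `s`. -/
def HasSupp (F : FIR p m) (s : Set ℤ) : Prop := ∀ i j, ∀ k ∉ s, (F i j).coeff k = 0

open Pointwise in
lemma HasSupp.mulVec_mem {F : FIR p m} {s t u : Set ℤ} (hF : HasSupp F s)
    {f : Fin m → ℂ[T;T⁻¹]} (hf : f ∈ supp m t) (h : s + t ⊆ u) : F *ᵥ f ∈ supp p u := by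
  intro i k hk
  simp only [Matrix.mulVec, dotProduct, AddMonoidAlgebra.coeff_sum, Finsupp.coe_finsetSum,
    Finset.sum_apply]
  exact Finset.sum_eq_zero fun j _ =>
    coeff_mul_eq_zero (hF i j) (hf j) fun hk' => hk (h hk')

open Pointwise in
lemma HasSupp.mul {F : FIR p m} {G : FIR m n} {s t u : Set ℤ} (hF : HasSupp F s)
    (hG : HasSupp G t) (h : s + t ⊆ u) : HasSupp (F * G) u := by
  intro i j k hk
  simp only [Matrix.mul_apply, AddMonoidAlgebra.coeff_sum, Finsupp.coe_finsetSum,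
    Finset.sum_apply]
  exact Finset.sum_eq_zero fun l _ =>
    coeff_mul_eq_zero (hF i l) (hG l j) fun hk' => hk (h hk')

lemma HasSupp.mono {F : FIR p m} {s t : Set ℤ} (hF : HasSupp F s) (h : s ⊆ t) : HasSupp F t :=
  fun i j k hk => hF i j k fun hs => hk (h hs)

open Pointwise in
lemma Ici_add_Ici_subset : Set.Ici (0 : ℤ) + Set.Ici 0 ⊆ Set.Ici 0 := by
  rintro _ ⟨a, ha, b, hb, rfl⟩
  exact add_nonneg (Set.mem_Ici.1 ha) hb

open Pointwise in
lemma Iic_add_Iic_subset : Set.Iic (0 : ℤ) + Set.Iic 0 ⊆ Set.Iic 0 := by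
  rintro _ ⟨a, ha, b, hb, rfl⟩
  exact add_nonpos (Set.mem_Iic.1 ha) hb

lemma hasSupp_const (U : Matrix (Fin p) (Fin m) ℂ) : HasSupp (const U) {0} := by
  intro i j k hk
  simp only [Set.mem_singleton_iff] at hk
  simp [const, hk]

lemma hasSupp_factor (k : ℤ) (v : Fin p → ℂ) : HasSupp (factor (T k) v) {0, k} := by
  intro i j l hl
  simp only [Set.mem_insert_iff, Set.mem_singleton_iff, not_or] at hl
  rw [factor_apply, ← map_mul]
  have h1 : ((1 : FIR p p) i j).coeff l = 0 := by
    rw [← const_one]; exact hasSupp_const 1 i j l (by simpa using hl.1)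
  have h2 : l - k ≠ 0 := sub_ne_zero.2 hl.2
  simp [h1, sub_mul, hl.1, h2]

lemma exists_hasSupp_Ici (F : FIR p m) : ∃ K : ℕ, HasSupp F (Set.Ici (-(K : ℤ))) := by
  have h : ∀ f : ℂ[T;T⁻¹], ∃ K : ℕ, ∀ k ∉ Set.Ici (-(K : ℤ)), f.coeff k = 0 := by
    intro f
    refine ⟨f.coeff.support.sup Int.natAbs, fun k hk => ?_⟩
    by_contra h0
    have := Finset.le_sup (f := Int.natAbs) (Finsupp.mem_support_iff.2 h0)
    simp only [Set.mem_Ici, not_le] at hk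
    omega
  choose K hK using h
  refine ⟨∑ i, ∑ j, K (F i j), fun i j k hk => hK _ _ fun hk' => hk ?_⟩
  have h1 : K (F i j) ≤ ∑ j, K (F i j) :=
    Finset.single_le_sum (f := fun j => K (F i j)) (fun _ _ => Nat.zero_le _) (Finset.mem_univ j)
  have h2 : ∑ j, K (F i j) ≤ ∑ i, ∑ j, K (F i j) :=
    Finset.single_le_sum (f := fun i => ∑ j, K (F i j)) (fun _ _ => Nat.zero_le _)
      (Finset.mem_univ i)
  simp only [Set.mem_Ici] at hk' ⊢
  omega

instance finiteDimensional_supp (s : Finset ℤ) : FiniteDimensional ℂ (supp p (s : Set ℤ)) := by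
  let φ : supp p (s : Set ℤ) →ₗ[ℂ] (Fin p → s → ℂ) :=
    { toFun := fun f i k => (f.1 i).coeff k
      map_add' := by intro f g; ext; simp
      map_smul' := by intro c f; ext; simp }
  refine FiniteDimensional.of_injective φ fun f g h => Subtype.ext (funext fun i => ?_)
  ext k
  by_cases hk : k ∈ s
  · exact congrFun (congrFun h i) ⟨k, hk⟩
  · rw [f.2 i k hk, g.2 i k hk]

/-- The projection of vectors of Laurent polynomials onto their strictly negative exponents. -/
def negPart : (Fin p → ℂ[T;T⁻¹]) →ₗ[ℂ] (Fin p → ℂ[T;T⁻¹]) where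
  toFun f i := AddMonoidAlgebra.ofCoeff ((f i).coeff.filter fun k => k < 0)
  map_add' f g := by ext; simp [Finsupp.filter_add]
  map_smul' c f := by ext; simp [Finsupp.filter_smul]

@[simp] lemma coeff_negPart (f : Fin p → ℂ[T;T⁻¹]) (i : Fin p) (k : ℤ) :
    (negPart f i).coeff k = if k < 0 then (f i).coeff k else 0 := by
  simp [negPart, Finsupp.filter_apply]

lemma negPart_mem (f : Fin p → ℂ[T;T⁻¹]) : negPart f ∈ supp p (Set.Iio 0) := by
  intro i k hk
  simp only [Set.mem_Iio] at hk
  simp [hk]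

lemma negPart_eq_zero {f : Fin p → ℂ[T;T⁻¹]} : negPart f = 0 ↔ f ∈ supp p (Set.Ici 0) := by
  constructor
  · intro h i k hk
    have := congrArg (fun g => (g i).coeff k) h
    simp only [Set.mem_Ici, not_le] at hk
    simpa [hk] using this
  · intro h
    ext i k
    by_cases hk : k < 0
    · simpa [hk] using h i k (by simpa using hk)
    · simp [hk]

lemma negPart_eq_self {f : Fin p → ℂ[T;T⁻¹]} (h : f ∈ supp p (Set.Iio 0)) : negPart f = f := by
  ext i k
  by_cases hk : k < 0
  · simp [hk]
  · simp [hk, h i k (by simpa using hk)]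

lemma negPart_negPart (f : Fin p → ℂ[T;T⁻¹]) : negPart (negPart f) = negPart f :=
  negPart_eq_self (negPart_mem f)

lemma sub_negPart_mem (f : Fin p → ℂ[T;T⁻¹]) : f - negPart f ∈ supp p (Set.Ici 0) := by
  rw [← negPart_eq_zero, map_sub, negPart_negPart, sub_self]

/-- Multiplication of vectors by the matrix `F`, followed by the projection onto strictly negative
exponents. -/
def negMul (F : FIR p m) : (Fin m → ℂ[T;T⁻¹]) →ₗ[ℂ] (Fin p → ℂ[T;T⁻¹]) :=
  negPart ∘ₗ (Matrix.mulVecLin F).restrictScalars ℂ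

@[simp] lemma negMul_apply (F : FIR p m) (f : Fin m → ℂ[T;T⁻¹]) :
    negMul F f = negPart (F *ᵥ f) := rfl

/-- The range of the Hankel operator of `F`: the strictly negative parts of all `F q`, with `q` a
vector of polynomials in `z`. Its dimension is the McMillan degree of the causal part of `F`. -/
def hankelSpace (F : FIR p m) : Submodule ℂ (Fin p → ℂ[T;T⁻¹]) :=
  (supp m (Set.Ici 0)).map (negMul F)

lemma hankelSpace_le_neg (F : FIR p m) : hankelSpace F ≤ supp p (Set.Iio 0) := by
  rintro _ ⟨q, -, rfl⟩
  exact negPart_mem _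

open Pointwise in
lemma exists_hankelSpace_le (F : FIR p m) :
    ∃ K : ℕ, hankelSpace F ≤ supp p (Set.Ico (-(K : ℤ)) 0) := by
  obtain ⟨K, hK⟩ := exists_hasSupp_Ici F
  refine ⟨K, ?_⟩
  rintro _ ⟨q, hq, rfl⟩ i k hk
  rw [negMul_apply, coeff_negPart]
  split_ifs with h0
  · refine hK.mulVec_mem (u := Set.Ici (-(K : ℤ))) hq ?_ i k fun h => hk ⟨h, h0⟩
    rintro _ ⟨a, ha, b, hb, rfl⟩
    simp only [Set.mem_Ici] at ha hb ⊢
    omega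
  · rfl

instance finiteDimensional_hankelSpace (F : FIR p m) : FiniteDimensional ℂ (hankelSpace F) := by
  obtain ⟨K, hK⟩ := exists_hankelSpace_le F
  rw [← Finset.coe_Ico] at hK
  exact Submodule.finiteDimensional_of_le hK

/-- The rank of the Hankel operator of `F`. -/
def hankelRank (F : FIR p m) : ℕ := Module.finrank ℂ (hankelSpace F)

lemma hankelSpace_eq_bot {F : FIR p m} : hankelSpace F = ⊥ ↔ HasSupp F (Set.Ici 0) := by
  constructor
  · intro h i j k hk
    have h1 : negPart (F *ᵥ Pi.single j 1) = 0 := by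
      rw [← Submodule.mem_bot ℂ, ← h]
      refine ⟨Pi.single j 1, fun i k hk => ?_, rfl⟩
      simp only [Set.mem_Ici, not_le] at hk
      by_cases hi : i = j
      · subst hi
        have : (0 : ℤ) ≠ k := by omega
        rw [Pi.single_eq_same, ← LaurentPolynomial.T_zero, LaurentPolynomial.T_apply, if_neg this]
      · simp [hi]
    have h2 := negPart_eq_zero.1 h1 i k hk
    simpa using h2
  · intro h
    rw [eq_bot_iff]
    rintro _ ⟨q, hq, rfl⟩
    exact negPart_eq_zero.2 (h.mulVec_mem hq Ici_add_Ici_subset)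

lemma hankelRank_eq_zero {F : FIR p m} : hankelRank F = 0 ↔ HasSupp F (Set.Ici 0) := by
  rw [hankelRank, Submodule.finrank_eq_zero, hankelSpace_eq_bot]

/-- The Hankel space only depends on the strictly negative powers. -/
lemma hankelSpace_congr {F G : FIR p m} (h : HasSupp (F - G) (Set.Ici 0)) :
    hankelSpace F = hankelSpace G := by
  refine SetLike.coe_injective (Set.image_congr fun q hq => ?_)
  have : negPart ((F - G) *ᵥ q) = 0 := negPart_eq_zero.2 (h.mulVec_mem hq Ici_add_Ici_subset)
  rwa [Matrix.sub_mulVec, map_sub, sub_eq_zero] at this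

/-! ### Hankel spaces of products -/

/-- A matrix without negative powers maps vectors without negative powers to such vectors, so the
negative part of `M f` depends on that of `f` only. -/
lemma negPart_mulVec_negPart {M : FIR p n} (hM : HasSupp M (Set.Ici 0)) (f : Fin n → ℂ[T;T⁻¹]) :
    negPart (M *ᵥ negPart f) = negPart (M *ᵥ f) := by
  have := negPart_eq_zero.2 (hM.mulVec_mem (sub_negPart_mem f) Ici_add_Ici_subset)
  rw [Matrix.mulVec_sub, map_sub, sub_eq_zero] at this
  exact this.symm

lemma hankelSpace_mul_of_hasSupp {M : FIR p n} (hM : HasSupp M (Set.Ici 0)) (G : FIR n m) :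
    hankelSpace (M * G) = (hankelSpace G).map (negMul M) := by
  rw [hankelSpace, hankelSpace, ← Submodule.map_comp]
  refine SetLike.coe_injective (Set.image_congr fun q _ => ?_)
  simp [negPart_mulVec_negPart hM, Matrix.mulVec_mulVec]

lemma hankelRank_mul_le {M : FIR p n} (hM : HasSupp M (Set.Ici 0)) (G : FIR n m) :
    hankelRank (M * G) ≤ hankelRank G := by
  rw [hankelRank, hankelSpace_mul_of_hasSupp hM]
  exact Submodule.finrank_map_le _ _

lemma factor_mulVec (b : ℂ[T;T⁻¹]) (v : Fin p → ℂ) (f : Fin p → ℂ[T;T⁻¹]) :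
    factor b v *ᵥ f = f + fun i => (b - 1) * (∑ j, C (star (v j)) * f j) * C (v i) := by
  funext i
  simp only [Matrix.mulVec, dotProduct, factor_apply, add_mul, Finset.sum_add_distrib]
  congr 1
  · simp [Matrix.one_apply]
  · simp only [Finset.mul_sum, Finset.sum_mul]
    exact Finset.sum_congr rfl fun j _ => by ring

lemma hasSupp_factor_T_one (v : Fin p → ℂ) : HasSupp (factor (T 1) v) (Set.Ici 0) :=
  (hasSupp_factor 1 v).mono (by rintro k (rfl | rfl) <;> simp)

lemma hasSupp_factor_T_neg_one (v : Fin p → ℂ) : HasSupp (factor (T (-1)) v) (Set.Iic 0) :=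
  (hasSupp_factor (-1) v).mono (by rintro k (rfl | rfl) <;> simp)

/-- The vector `a z ^ k`. -/
def mono (k : ℤ) (a : Fin p → ℂ) : Fin p → ℂ[T;T⁻¹] := fun i => C (a i) * T k

@[simp] lemma coeff_mono (k : ℤ) (a : Fin p → ℂ) (i : Fin p) (l : ℤ) :
    (mono k a i).coeff l = if k = l then a i else 0 := by
  rw [mono, coeff_C_mul, LaurentPolynomial.T_apply]
  simp

lemma mono_mem {k : ℤ} {s : Set ℤ} (hk : k ∈ s) (a : Fin p → ℂ) : mono k a ∈ supp p s := by
  intro i l hl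
  have : k ≠ l := by rintro rfl; exact hl hk
  simp [this]

lemma mono_smul (k : ℤ) (c : ℂ) (a : Fin p → ℂ) : mono k (c • a) = c • mono k a := by
  ext i l
  by_cases h : k = l <;> simp [h]

lemma eq_mono_of_mem {k : ℤ} {f : Fin p → ℂ[T;T⁻¹]} (hf : f ∈ supp p {k}) :
    f = mono k fun i => (f i).coeff k := by
  ext i l
  by_cases h : k = l
  · subst h; simp
  · rw [hf i l (by simpa using Ne.symm h)]; simp [h]

/-- A causal elementary factor raises the Hankel rank by at most one. -/
lemma hankelRank_factor_mul_le (v : Fin p → ℂ) (G : FIR p m) :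
    hankelRank (factor (T (-1)) v * G) ≤ hankelRank G + 1 := by
  have hle : hankelSpace (factor (T (-1)) v * G) ≤
      (hankelSpace G).map (negMul (factor (T (-1)) v)) ⊔ Submodule.span ℂ {mono (-1) v} := by
    rintro _ ⟨q, hq, rfl⟩
    have hsplit : negPart ((factor (T (-1)) v * G) *ᵥ q) =
        negPart (factor (T (-1)) v *ᵥ negPart (G *ᵥ q)) +
          negPart (factor (T (-1)) v *ᵥ (G *ᵥ q - negPart (G *ᵥ q))) := by
      rw [← map_add, ← Matrix.mulVec_add, add_sub_cancel, Matrix.mulVec_mulVec]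
    rw [negMul_apply, hsplit]
    refine Submodule.add_mem_sup ⟨_, ⟨q, hq, rfl⟩, rfl⟩ ?_
    -- only the constant term `r₀` of `r` matters: the negative part is `(v* r₀) v / z`
    set r := G *ᵥ q - negPart (G *ᵥ q)
    have hr : r ∈ supp p (Set.Ici 0) := sub_negPart_mem _
    rw [Submodule.mem_span_singleton]
    refine ⟨∑ j, star (v j) * (r j).coeff 0, ?_⟩
    rw [factor_mulVec]
    ext i k
    have hsum : ∀ l : ℤ, (∑ j, C (star (v j)) * r j).coeff l = ∑ j, star (v j) * (r j).coeff l := by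
      intro l; simp
    rw [coeff_negPart, Pi.add_apply, AddMonoidAlgebra.coeff_add, Finsupp.add_apply, coeff_mul_C,
      sub_mul, one_mul, AddMonoidAlgebra.coeff_sub, Finsupp.sub_apply, coeff_T_mul, hsum, hsum]
    have hneg : ∀ l < 0, ∀ j, (r j).coeff l = 0 := fun l hl j => hr j l (by simpa using hl)
    simp only [Pi.smul_apply, AddMonoidAlgebra.coeff_smul, Finsupp.smul_apply, coeff_mono,
      smul_eq_mul]
    rcases lt_trichotomy k (-1) with hk | rfl | hk
    · have h1 : k < 0 := by omega
      have h2 : k - -1 < 0 := by omega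
      simp only [hneg k h1, hneg _ h2, h1, hk.ne']
      simp
    · simp [hneg (-1) (by omega)]
    · have h1 : ¬ k < 0 := by omega
      simp [h1, hk.ne]
  calc hankelRank (factor (T (-1)) v * G)
      ≤ Module.finrank ℂ ↥((hankelSpace G).map (negMul (factor (T (-1)) v)) ⊔
          Submodule.span ℂ {mono (-1) v}) := Submodule.finrank_mono hle
    _ ≤ Module.finrank ℂ ↥((hankelSpace G).map (negMul (factor (T (-1)) v))) +
          Module.finrank ℂ ↥(Submodule.span ℂ {mono (-1) v}) :=
        Submodule.finrank_add_le_finrank_add_finrank _ _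
    _ ≤ hankelRank G + 1 := by
      gcongr
      · exact Submodule.finrank_map_le _ _
      · exact (finrank_span_le_card ({mono (-1) v} : Set (Fin p → ℂ[T;T⁻¹]))).trans (by simp)

/-! ### Shift invariance -/

/-- The shift `y ↦ (z y)₋` on vectors of Laurent polynomials. -/
def shift : (Fin p → ℂ[T;T⁻¹]) →ₗ[ℂ] (Fin p → ℂ[T;T⁻¹]) where
  toFun y := negPart ((T 1 : ℂ[T;T⁻¹]) • y)
  map_add' f g := by rw [smul_add, map_add]
  map_smul' c f := by rw [smul_comm, map_smul]; rfl

lemma coeff_shift (y : Fin p → ℂ[T;T⁻¹]) (i : Fin p) (k : ℤ) :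
    (shift y i).coeff k = if k < 0 then (y i).coeff (k - 1) else 0 := by
  change (negPart ((T 1 : ℂ[T;T⁻¹]) • y) i).coeff k = _
  rw [coeff_negPart, Pi.smul_apply, smul_eq_mul, coeff_T_mul]

lemma shift_mem_hankelSpace {F : FIR p m} {y : Fin p → ℂ[T;T⁻¹]} (hy : y ∈ hankelSpace F) :
    shift y ∈ hankelSpace F := by
  obtain ⟨q, hq, rfl⟩ := hy
  refine ⟨(T 1 : ℂ[T;T⁻¹]) • q, fun i k hk => ?_, ?_⟩
  · simp only [Set.mem_Ici, not_le] at hk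
    simp only [Pi.smul_apply, smul_eq_mul, coeff_T_mul]
    exact hq i _ (by simp only [Set.mem_Ici, not_le]; omega)
  · ext i k
    simp only [negMul_apply, Matrix.mulVec_smul, coeff_negPart, Pi.smul_apply, smul_eq_mul,
      coeff_T_mul, coeff_shift]
    by_cases hk : k < 0
    · have : k - 1 < 0 := by omega
      simp [hk, this]
    · simp [hk]

/-- A nonzero Hankel space contains a vector `v / z` with `v` of norm one, since it is stable
under `y ↦ (z y)₋`, which is nilpotent on it. -/
lemma exists_mono_mem_hankelSpace {F : FIR p m} (h : hankelSpace F ≠ ⊥) :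
    ∃ v : Fin p → ℂ, star v ⬝ᵥ v = 1 ∧ mono (-1) v ∈ hankelSpace F := by
  -- apply the shift to a nonzero `y` for as long as the result is nonzero
  have key : ∀ (K : ℕ) (y : Fin p → ℂ[T;T⁻¹]), y ∈ hankelSpace F → y ≠ 0 →
      y ∈ supp p (Set.Ico (-(K : ℤ)) 0) → ∃ v : Fin p → ℂ, v ≠ 0 ∧ mono (-1) v ∈ hankelSpace F := by
    intro K
    induction K with
    | zero =>
      intro y _ hy0 hy
      exact absurd (by ext i k; simpa using hy i k (by simp)) hy0
    | succ K ih =>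
      intro y hyF hy0 hy
      by_cases hz : shift y = 0
      · have hy1 : y ∈ supp p {-1} := by
          intro i k hk
          by_cases hk0 : k < 0
          · have h1 := negPart_eq_zero.1 hz i (k + 1) (by
              simp only [Set.mem_singleton_iff] at hk
              simp only [Set.mem_Ici, not_le]; omega)
            simpa using h1
          · exact hy i k fun h => hk0 h.2
        have h2 := eq_mono_of_mem hy1
        refine ⟨_, ?_, h2 ▸ hyF⟩
        intro h0
        rw [h0] at h2
        apply hy0
        rw [h2]
        ext; simp
      · refine ih _ (shift_mem_hankelSpace hyF) hz fun i k hk => ?_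
        rw [coeff_shift]
        split_ifs with h0
        · refine hy i _ fun h => hk ⟨?_, h0⟩
          have := h.1
          push_cast at this
          omega
        · rfl
  obtain ⟨y, hy, hy0⟩ := (Submodule.ne_bot_iff _).1 h
  obtain ⟨K, hK⟩ := exists_hankelSpace_le F
  obtain ⟨w, hw0, hw⟩ := key K y hy hy0 (hK hy)
  have hpos : 0 < ∑ i, ‖w i‖ ^ 2 := by
    obtain ⟨i, hi⟩ := Function.ne_iff.1 hw0
    refine Finset.sum_pos' (fun i _ => by positivity) ⟨i, Finset.mem_univ i, ?_⟩
    have : 0 < ‖w i‖ := norm_pos_iff.2 hi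
    positivity
  set r : ℝ := ∑ i, ‖w i‖ ^ 2 with hr
  have hww : star w ⬝ᵥ w = (r : ℂ) := by
    simp [dotProduct, hr, Complex.conj_mul']
  refine ⟨((Real.sqrt r)⁻¹ : ℂ) • w, ?_, ?_⟩
  · have hs : (Real.sqrt r : ℂ) * (Real.sqrt r : ℂ) = r := by
      rw [← Complex.ofReal_mul, Real.mul_self_sqrt hpos.le]
    have hs0 : (Real.sqrt r : ℂ) ≠ 0 := by
      rw [Complex.ofReal_ne_zero]; exact (Real.sqrt_pos.2 hpos).ne'
    rw [star_smul, smul_dotProduct, dotProduct_smul, hww, ← hs]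
    simp only [smul_eq_mul, star_inv₀, Complex.star_def, Complex.conj_ofReal]
    field_simp
  · rw [mono_smul]
    exact Submodule.smul_mem _ _ hw

/-! ### The inner product of vectors of Laurent polynomials -/

/-- The inner product `∑ i k, conj (f i k) * g i k`, written as the constant coefficient of
`f♯ g`. -/
def pair (f g : Fin p → ℂ[T;T⁻¹]) : ℂ := (∑ i, parConj (f i) * g i).coeff 0

lemma pair_sub_right (f g h : Fin p → ℂ[T;T⁻¹]) : pair f (g - h) = pair f g - pair f h := by
  simp [pair, mul_sub, Finset.sum_sub_distrib]

lemma pair_sub_left (f g h : Fin p → ℂ[T;T⁻¹]) : pair (f - g) h = pair f h - pair g h := by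
  simp [pair, sub_mul, Finset.sum_sub_distrib]

lemma pair_smul_left (c : ℂ) (f g : Fin p → ℂ[T;T⁻¹]) : pair (c • f) g = star c * pair f g := by
  simp only [pair, Pi.smul_apply, LaurentPolynomial.smul_eq_C_mul, map_mul, parConj_C, mul_assoc,
    ← Finset.mul_sum, coeff_C_mul]

lemma pair_T_smul (k : ℤ) (f g : Fin p → ℂ[T;T⁻¹]) :
    pair ((T k : ℂ[T;T⁻¹]) • f) ((T k : ℂ[T;T⁻¹]) • g) = pair f g := by
  have h : ∀ i, parConj (T k * f i) * (T k * g i) = parConj (f i) * g i := by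
    intro i
    rw [map_mul, parConj_T, mul_mul_mul_comm, ← LaurentPolynomial.T_add]
    simp
  simp only [pair, Pi.smul_apply, smul_eq_mul, h]

lemma pair_mulVec_left (F : FIR p m) (f : Fin m → ℂ[T;T⁻¹]) (g : Fin p → ℂ[T;T⁻¹]) :
    pair (F *ᵥ f) g = pair f (adj F *ᵥ g) := by
  simp only [pair, Matrix.mulVec, dotProduct, map_sum, map_mul, Finset.sum_mul, Finset.mul_sum,
    adj_apply]
  rw [Finset.sum_comm]
  refine congrArg (fun f : ℂ[T;T⁻¹] => f.coeff 0) ?_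
  exact Finset.sum_congr rfl fun i _ => Finset.sum_congr rfl fun j _ => by ring

lemma pair_mulVec_mulVec {F : FIR p m} (hF : adj F * F = 1) (f g : Fin m → ℂ[T;T⁻¹]) :
    pair (F *ᵥ f) (F *ᵥ g) = pair f g := by
  rw [pair_mulVec_left, Matrix.mulVec_mulVec, hF, Matrix.one_mulVec]

lemma pair_eq_zero {s t : Set ℤ} (hst : Disjoint s t) {f g : Fin p → ℂ[T;T⁻¹]}
    (hf : f ∈ supp p s) (hg : g ∈ supp p t) : pair f g = 0 := by
  rw [pair, AddMonoidAlgebra.coeff_sum, Finsupp.coe_finsetSum, Finset.sum_apply]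
  refine Finset.sum_eq_zero fun i _ => ?_
  refine coeff_mul_eq_zero (s := {k | -k ∈ s}) (fun k hk => ?_) (hg i) ?_
  · rw [coeff_parConj, hf i _ hk, star_zero]
  · rintro ⟨a, ha, b, hb, hab⟩
    have hb' : b = -a := by linarith
    exact Set.disjoint_left.1 hst ha (hb' ▸ hb)

lemma pair_mono (k : ℤ) (a b : Fin p → ℂ) : pair (mono k a) (mono k b) = star a ⬝ᵥ b := by
  simp only [pair, mono, map_mul, parConj_C, parConj_T, dotProduct, Pi.star_apply]
  rw [AddMonoidAlgebra.coeff_sum, Finsupp.coe_finsetSum, Finset.sum_apply]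
  refine Finset.sum_congr rfl fun i _ => ?_
  rw [mul_mul_mul_comm, ← LaurentPolynomial.T_add, ← map_mul]
  simp

/-! ### Splitting off an elementary factor -/

lemma factor_T_mulVec_mono (k l : ℤ) {v : Fin p → ℂ} (hv : star v ⬝ᵥ v = 1) :
    factor (T k) v *ᵥ mono l v = mono (k + l) v := by
  have h : ∑ j, C (star (v j)) * mono l v j = T l := by
    have : C (star v ⬝ᵥ v) = (1 : ℂ[T;T⁻¹]) := by rw [hv, map_one]
    rw [← one_mul (T l), ← this]
    simp [dotProduct, mono, Finset.sum_mul, mul_assoc]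
  rw [factor_mulVec, h]
  funext i
  simp only [Pi.add_apply, mono, LaurentPolynomial.T_add]
  ring

/-- If `y` has negative exponents only, while `(I + (z - 1) v v*) y` has none, then `y` is a
multiple of `v / z`. -/
lemma exists_eq_smul_mono {v : Fin p → ℂ} (hv : star v ⬝ᵥ v = 1) {y : Fin p → ℂ[T;T⁻¹]}
    (hy : y ∈ supp p (Set.Iio 0)) (h : factor (T 1) v *ᵥ y ∈ supp p (Set.Ici 0)) :
    ∃ c : ℂ, y = c • mono (-1) v := by
  set t : ℤ → ℂ := fun k => ∑ j, star (v j) * (y j).coeff k with ht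
  have hsum : ∀ l : ℤ, (∑ j, C (star (v j)) * y j).coeff l = t l := by
    intro l; simp [ht]
  have hcoef : ∀ k < 0, ∀ i, (y i).coeff k + (t (k - 1) - t k) * v i = 0 := by
    intro k hk i
    have := h i k (by simpa using hk)
    rw [factor_mulVec, Pi.add_apply, AddMonoidAlgebra.coeff_add, Finsupp.add_apply, coeff_mul_C,
      sub_mul, one_mul, AddMonoidAlgebra.coeff_sub, Finsupp.sub_apply, coeff_T_mul, hsum,
      hsum] at this
    exact this
  -- multiplying the coefficients of `(I + (z - 1) v v*) y` by `v*` leaves `t (k - 1)`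
  have ht0 : ∀ k < 0, t (k - 1) = 0 := by
    intro k hk
    have h1 : ∑ i, star (v i) * ((y i).coeff k + (t (k - 1) - t k) * v i) = 0 :=
      Finset.sum_eq_zero fun i _ => by rw [hcoef k hk i, mul_zero]
    have h2 : ∑ i, star (v i) * ((y i).coeff k + (t (k - 1) - t k) * v i) =
        t k + (t (k - 1) - t k) * (star v ⬝ᵥ v) := by
      simp only [mul_add, Finset.sum_add_distrib, dotProduct, Finset.mul_sum, Pi.star_apply]
      congr 1
      exact Finset.sum_congr rfl fun i _ => by ring
    rw [h2, hv] at h1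
    linear_combination h1
  refine ⟨t (-1), ?_⟩
  ext i k
  simp only [Pi.smul_apply, AddMonoidAlgebra.coeff_smul, Finsupp.smul_apply, coeff_mono,
    smul_eq_mul]
  rcases lt_trichotomy k (-1) with hk | rfl | hk
  · have h1 := hcoef k (by omega) i
    have h2 := ht0 (k + 1) (by omega)
    rw [add_sub_cancel_right] at h2
    rw [ht0 k (by omega), h2] at h1
    simp only [hk.ne', if_false, mul_zero]
    linear_combination h1
  · have h1 := hcoef (-1) (by omega) i
    rw [ht0 (-1) (by omega)] at h1
    simp only [if_true]
    linear_combination h1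
  · simp only [hk.ne, if_false, mul_zero]
    exact hy i k (by simp only [Set.mem_Iio]; omega)

lemma reflect_mulVec (F : FIR p m) (f : Fin m → ℂ[T;T⁻¹]) :
    (reflect F *ᵥ fun j => LaurentPolynomial.invert (f j)) =
      fun i => LaurentPolynomial.invert ((F *ᵥ f) i) := by
  funext i
  simp [reflect, Matrix.mulVec, dotProduct]

/-- Splitting off a factor found in the Hankel space lowers the Hankel rank. -/
lemma hankelRank_factor_mul_lt {F : FIR p m} {v : Fin p → ℂ} (hv : star v ⬝ᵥ v = 1)
    (hmem : mono (-1) v ∈ hankelSpace F) : hankelRank (factor (T 1) v * F) < hankelRank F := by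
  rw [hankelRank, hankelSpace_mul_of_hasSupp (hasSupp_factor_T_one v)]
  set φ := (negMul (factor (T 1) v)).domRestrict (hankelSpace F)
  have h1 := LinearMap.finrank_range_add_finrank_ker φ
  have hrange : LinearMap.range φ = (hankelSpace F).map (negMul (factor (T 1) v)) :=
    LinearMap.range_domRestrict _ _
  rw [hrange] at h1
  have hker : 0 < Module.finrank ℂ (LinearMap.ker φ) := by
    rw [Nat.pos_iff_ne_zero, Ne, Submodule.finrank_eq_zero, ← Ne, Submodule.ne_bot_iff]
    refine ⟨⟨_, hmem⟩, ?_, ?_⟩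
    · rw [LinearMap.mem_ker, LinearMap.domRestrict_apply, negMul_apply,
        factor_T_mulVec_mono _ _ hv, negPart_eq_zero]
      exact mono_mem (by simp) v
    · intro h0
      have h2 := congrArg Subtype.val h0
      have h3 : pair (mono (-1) v) (mono (-1) v) = 0 := by
        rw [show mono (-1) v = 0 from h2]; simp [pair]
      rw [pair_mono, hv] at h3
      exact one_ne_zero h3
  have h2 : hankelRank F = Module.finrank ℂ (hankelSpace F) := rfl
  omega

/-- Splitting off a causal factor found in the Hankel space of an isometric `F` does not raise
the Hankel rank on the anticausal side: the map `y ↦ (Λ y)₋`, with `Λ = I + (z - 1) v v*`, from the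
new Hankel space to the old one is injective. A vector of its kernel is `c v / z`, and isometry
of `F` forces `|c|² = 0`, since `z v` is the strictly positive part of a vector `F(1/z) h` with
`h` without positive powers. -/
lemma hankelRank_reflect_factor_mul_le {F : FIR p m} (hF : adj F * F = 1) {v : Fin p → ℂ}
    (hv : star v ⬝ᵥ v = 1) (hmem : mono (-1) v ∈ hankelSpace F) :
    hankelRank (reflect (factor (T 1) v * F)) ≤ hankelRank (reflect F) := by
  set G := reflect F with hG
  set G₁ := reflect (factor (T 1) v * F) with hG₁
  set Λ := factor (T 1) v with hΛ
  have hGiso : adj G * G = 1 := adj_reflect_mul_self hF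
  have hΛiso : adj Λ * Λ = 1 := adj_factor_mul_self 1 hv
  have hΛG : Λ * G₁ = G := by
    rw [hG₁, hΛ, reflect_mul, reflect_factor, LaurentPolynomial.invert_T,
      ← Matrix.mul_assoc, factor_mul_self_neg 1 hv, Matrix.one_mul]
  have hΛsupp := hasSupp_factor_T_one v
  have hmap : hankelSpace G = (hankelSpace G₁).map (negMul Λ) := by
    rw [← hankelSpace_mul_of_hasSupp hΛsupp, hΛG]
  suffices hinj : ∀ y ∈ hankelSpace G₁, negMul Λ y = 0 → y = 0 by
    rw [hankelRank, hankelRank, hmap]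
    refine le_of_eq (LinearEquiv.finrank_eq (LinearEquiv.ofBijective
      ((negMul Λ).submoduleMap (hankelSpace G₁)) ⟨?_, LinearMap.submoduleMap_surjective _ _⟩))
    rw [injective_iff_map_eq_zero]
    intro y hy
    exact Subtype.ext (hinj y.1 y.2 (congrArg Subtype.val hy))
  rintro y hyG₁ hy0
  have hyneg := hankelSpace_le_neg G₁ hyG₁
  have hΛy : Λ *ᵥ y ∈ supp p (Set.Ici 0) := negPart_eq_zero.1 hy0
  obtain ⟨q, hq, hqy⟩ := hyG₁
  obtain ⟨c, hc⟩ := exists_eq_smul_mono hv hyneg hΛy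
  have hr : G₁ *ᵥ q - y ∈ supp p (Set.Ici 0) := by
    rw [← hqy]; exact sub_negPart_mem _
  have hΛGq : Λ *ᵥ (G₁ *ᵥ q) = G *ᵥ q := by rw [Matrix.mulVec_mulVec, hΛG]
  have hGq : G *ᵥ q ∈ supp p (Set.Ici 0) := by
    have h1 := add_mem hΛy (hΛsupp.mulVec_mem hr Ici_add_Ici_subset)
    rwa [← hΛ, ← Matrix.mulVec_add, add_sub_cancel, hΛGq] at h1
  -- `v` is orthogonal to `G q`: up to exponents at most `0`, which `z G q` lacks, `z v` is `G h'`,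
  -- and `⟨G h', z G q⟩ = ⟨h', z q⟩` vanishes for reasons of support
  have hzero : pair (mono 0 v) (G *ᵥ q) = 0 := by
    obtain ⟨h, hh, hhv⟩ := hmem
    set h' : Fin m → ℂ[T;T⁻¹] := fun j => LaurentPolynomial.invert (h j) with hh'
    have hh'supp : h' ∈ supp m (Set.Iic 0) := by
      intro i k hk
      simp only [hh', LaurentPolynomial.invert_apply]
      exact hh i _ (by simpa using hk)
    have hw : G *ᵥ h' - mono 1 v ∈ supp p (Set.Iic 0) := by
      intro i k hk
      have hk' : 0 < k := by simpa using hk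
      have h1 := congrArg (fun f => (f i).coeff (-k)) hhv
      simp only [negMul_apply, coeff_negPart, Left.neg_neg_iff, hk', if_true, coeff_mono,
        neg_inj] at h1
      rw [hG, hh', reflect_mulVec]
      simp only [Pi.sub_apply, AddMonoidAlgebra.coeff_sub, Finsupp.sub_apply,
        LaurentPolynomial.invert_apply, coeff_mono]
      rw [h1, sub_self]
    have hT : ∀ {r : ℕ} {f : Fin r → ℂ[T;T⁻¹]}, f ∈ supp r (Set.Ici 0) →
        (T 1 : ℂ[T;T⁻¹]) • f ∈ supp r (Set.Ioi 0) := by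
      intro r f hf i k hk
      simp only [Pi.smul_apply, smul_eq_mul, coeff_T_mul]
      refine hf i _ ?_
      simp only [Set.mem_Ioi, Set.mem_Ici] at hk ⊢
      omega
    have hdisj : Disjoint (Set.Iic (0 : ℤ)) (Set.Ioi 0) := Set.Iic_disjoint_Ioi le_rfl
    have hmono : (T 1 : ℂ[T;T⁻¹]) • mono 0 v = mono 1 v := by
      funext i
      simp [mono]
    have h1 := pair_eq_zero hdisj hw (hT hGq)
    rw [pair_sub_left, ← Matrix.mulVec_smul, pair_mulVec_mulVec hGiso,
      pair_eq_zero hdisj hh'supp (hT hq), zero_sub, neg_eq_zero, Matrix.mulVec_smul, ← hmono,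
      pair_T_smul] at h1
    exact h1
  -- `⟨y, y⟩ = ⟨y, G₁ q⟩ = ⟨Λ y, G q⟩`, and `Λ y = c v`
  have h1 : pair y y = 0 := by
    have h2 : pair y (G₁ *ᵥ q - y) = 0 := pair_eq_zero (by
      rw [Set.disjoint_left]; intro a ha hb; exact not_le.2 (Set.mem_Iio.1 ha) hb) hyneg hr
    rw [pair_sub_right, sub_eq_zero] at h2
    rw [← h2, ← pair_mulVec_mulVec hΛiso, hΛGq, hc, Matrix.mulVec_smul, hΛ,
      factor_T_mulVec_mono _ _ hv, pair_smul_left]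
    simp [hzero]
  rw [hc, ← mono_smul, pair_mono, star_smul, smul_dotProduct, dotProduct_smul, hv] at h1
  have hc0 : c = 0 := by simpa using h1
  rw [hc, hc0, zero_smul]

/-! ### Factorization into elementary factors -/

/-- The product of the elementary factors `I + (z - 1) v v*`, `v` in `l₁`, of the factors
`I + (1/z - 1) v v*`, `v` in `l₂`, and of the constant `U`. -/
def listProduct (l₁ l₂ : List (Fin p → ℂ)) (U : Matrix (Fin p) (Fin m) ℂ) : FIR p m :=
  (l₁.map (factor (T 1))).prod * (l₂.map (factor (T (-1)))).prod * const U

lemma adj_mul_self_factor_mul {F : FIR p m} (k : ℤ) {v : Fin p → ℂ} (hv : star v ⬝ᵥ v = 1) :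
    adj (factor (T k) v * F) * (factor (T k) v * F) = adj F * F := by
  rw [adj_mul, Matrix.mul_assoc (adj F), ← Matrix.mul_assoc (adj (factor (T k) v)),
    adj_factor_mul_self k hv, Matrix.one_mul]

lemma eq_const_of_hasSupp {F : FIR p m} (h : HasSupp F (Set.Ici 0))
    (h' : HasSupp (reflect F) (Set.Ici 0)) : F = const (Matrix.of fun i j => (F i j).coeff 0) := by
  ext i j k
  rcases lt_trichotomy k 0 with hk | rfl | hk
  · rw [h i j k (by simpa using hk)]; simp [const, hk.ne]
  · simp [const]
  · have := h' i j (-k) (by simpa using hk)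
    simp only [reflect, Matrix.map_apply, LaurentPolynomial.invert_apply, neg_neg] at this
    rw [this]; simp [const, hk.ne']

/-- Factorization of a causal isometric FIR: causal factors are split off until the Hankel rank is
zero, and no positive power is ever created. -/
lemma factorization_of_causal (r : ℕ) {F : FIR p m} (hF : adj F * F = 1) (hr : hankelRank F ≤ r)
    (h0 : hankelRank (reflect F) = 0) :
    ∃ (l : List (Fin p → ℂ)) (U : Matrix (Fin p) (Fin m) ℂ), (∀ v ∈ l, star v ⬝ᵥ v = 1) ∧
      Uᴴ * U = 1 ∧ l.length ≤ r ∧ F = (l.map (factor (T (-1)))).prod * const U := by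
  induction r generalizing F with
  | zero =>
    have hc := eq_const_of_hasSupp (hankelRank_eq_zero.1 (Nat.le_zero.1 hr))
      (hankelRank_eq_zero.1 h0)
    refine ⟨[], _, by simp, ?_, le_rfl, by simpa using hc⟩
    apply const_injective
    rw [const_mul, ← adj_const, ← hc, hF, const_one]
  | succ r ih =>
    by_cases hb : hankelSpace F = ⊥
    · obtain ⟨l, U, h1, h2, h3, h4⟩ := ih hF (by rw [hankelRank, hb, finrank_bot]; simp) h0
      exact ⟨l, U, h1, h2, h3.trans (Nat.le_succ r), h4⟩
    · obtain ⟨v, hv, hmem⟩ := exists_mono_mem_hankelSpace hb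
      have hlt := hankelRank_factor_mul_lt hv hmem
      have hle := hankelRank_reflect_factor_mul_le hF hv hmem
      obtain ⟨l, U, h1, h2, h3, h4⟩ := ih (F := factor (T 1) v * F)
        (by rw [adj_mul_self_factor_mul 1 hv, hF]) (by omega) (by omega)
      refine ⟨v :: l, U, by simpa using ⟨hv, h1⟩, h2, by simpa using h3, ?_⟩
      rw [List.map_cons, List.prod_cons, Matrix.mul_assoc, ← h4,
        ← Matrix.mul_assoc]
      have := factor_mul_self_neg (-1) hv
      rw [neg_neg] at this
      rw [this, Matrix.one_mul]

/-- An isometric FIR is a product of as many elementary factors of either kind as its Hankel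
ranks allow. -/
theorem exists_eq_listProduct {F : FIR p m} (hF : adj F * F = 1) :
    ∃ (l₁ l₂ : List (Fin p → ℂ)) (U : Matrix (Fin p) (Fin m) ℂ), (∀ v ∈ l₁, star v ⬝ᵥ v = 1) ∧
      (∀ v ∈ l₂, star v ⬝ᵥ v = 1) ∧ Uᴴ * U = 1 ∧ l₁.length ≤ hankelRank (reflect F) ∧
      l₂.length ≤ hankelRank F ∧ F = listProduct l₁ l₂ U := by
  suffices h : ∀ (r : ℕ) (F : FIR p m), adj F * F = 1 → hankelRank (reflect F) ≤ r →
      ∃ (l₁ l₂ : List (Fin p → ℂ)) (U : Matrix (Fin p) (Fin m) ℂ), (∀ v ∈ l₁, star v ⬝ᵥ v = 1) ∧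
      (∀ v ∈ l₂, star v ⬝ᵥ v = 1) ∧ Uᴴ * U = 1 ∧ l₁.length ≤ r ∧
      l₂.length ≤ hankelRank F ∧ F = listProduct l₁ l₂ U from h _ F hF le_rfl
  clear hF F
  intro r
  induction r with
  | zero =>
    intro F hF hr
    obtain ⟨l, U, h1, h2, h3, h4⟩ := factorization_of_causal _ hF le_rfl (Nat.le_zero.1 hr)
    exact ⟨[], l, U, by simp, h1, h2, le_rfl, h3, by simpa [listProduct] using h4⟩
  | succ r ih =>
    intro F hF hr
    by_cases hb : hankelSpace (reflect F) = ⊥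
    · obtain ⟨l₁, l₂, U, h1, h2, h3, h4, h5, h6⟩ :=
        ih F hF (by rw [hankelRank, hb, finrank_bot]; simp)
      exact ⟨l₁, l₂, U, h1, h2, h3, h4.trans (Nat.le_succ r), h5, h6⟩
    · obtain ⟨v, hv, hmem⟩ := exists_mono_mem_hankelSpace hb
      have hlt := hankelRank_factor_mul_lt hv hmem
      have hle := hankelRank_reflect_factor_mul_le (adj_reflect_mul_self hF) hv hmem
      have hrefl : factor (T 1) v * reflect F = reflect (factor (T (-1)) v * F) := by
        rw [reflect_mul, reflect_factor, LaurentPolynomial.invert_T, neg_neg]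
      rw [hrefl, reflect_reflect, reflect_reflect] at hle
      rw [hrefl] at hlt
      obtain ⟨l₁, l₂, U, h1, h2, h3, h4, h5, h6⟩ := ih (factor (T (-1)) v * F)
        (by rw [adj_mul_self_factor_mul (-1) hv, hF]) (by omega)
      refine ⟨v :: l₁, l₂, U, by simpa using ⟨hv, h1⟩, h2, h3, by simpa using h4, h5.trans hle, ?_⟩
      have h7 : listProduct (v :: l₁) l₂ U = factor (T 1) v * listProduct l₁ l₂ U := by
        simp only [listProduct, List.map_cons, List.prod_cons, Matrix.mul_assoc]
      rw [h7, ← h6, ← Matrix.mul_assoc, factor_mul_self_neg 1 hv, Matrix.one_mul]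

/-! ### Properties of the products -/

lemma adj_mul_self_listProd {k : ℤ} {l : List (Fin p → ℂ)} (hl : ∀ v ∈ l, star v ⬝ᵥ v = 1)
    (F : FIR p m) :
    adj ((l.map (factor (T k))).prod * F) * ((l.map (factor (T k))).prod * F) = adj F * F := by
  induction l with
  | nil => simp
  | cons v l ih =>
    rw [List.map_cons, List.prod_cons, Matrix.mul_assoc,
      adj_mul_self_factor_mul k (hl v List.mem_cons_self),
      ih fun w hw => hl w (List.mem_cons_of_mem v hw)]

lemma adj_mul_self_listProduct {l₁ l₂ : List (Fin p → ℂ)} {U : Matrix (Fin p) (Fin m) ℂ}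
    (h₁ : ∀ v ∈ l₁, star v ⬝ᵥ v = 1) (h₂ : ∀ v ∈ l₂, star v ⬝ᵥ v = 1) (hU : Uᴴ * U = 1) :
    adj (listProduct l₁ l₂ U) * listProduct l₁ l₂ U = 1 := by
  rw [listProduct, Matrix.mul_assoc, adj_mul_self_listProd h₁, adj_mul_self_listProd h₂,
    adj_const, ← const_mul, hU, const_one]

lemma hankelRank_listProd_T_one_mul_le (l : List (Fin p → ℂ)) (G : FIR p m) :
    hankelRank ((l.map (factor (T 1))).prod * G) ≤ hankelRank G := by
  induction l with
  | nil => simp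
  | cons v l ih =>
    rw [List.map_cons, List.prod_cons, Matrix.mul_assoc]
    exact (hankelRank_mul_le (hasSupp_factor_T_one v) _).trans ih

lemma hankelRank_listProd_T_neg_one_mul_le (l : List (Fin p → ℂ)) (G : FIR p m) :
    hankelRank ((l.map (factor (T (-1)))).prod * G) ≤ hankelRank G + l.length := by
  induction l with
  | nil => simp
  | cons v l ih =>
    rw [List.map_cons, List.prod_cons, Matrix.mul_assoc, List.length_cons]
    have := hankelRank_factor_mul_le v ((l.map (factor (T (-1)))).prod * G)
    omega

lemma hankelRank_const (U : Matrix (Fin p) (Fin m) ℂ) : hankelRank (const U) = 0 :=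
  hankelRank_eq_zero.2 ((hasSupp_const U).mono (by simp))

lemma hankelRank_listProduct_le (l₁ l₂ : List (Fin p → ℂ)) (U : Matrix (Fin p) (Fin m) ℂ) :
    hankelRank (listProduct l₁ l₂ U) ≤ l₂.length := by
  have h1 := hankelRank_listProd_T_one_mul_le l₁ ((l₂.map (factor (T (-1)))).prod * const U)
  have h2 := hankelRank_listProd_T_neg_one_mul_le l₂ (const U)
  rw [hankelRank_const] at h2
  rw [listProduct, Matrix.mul_assoc]
  omega

lemma reflect_listProd (k : ℤ) (l : List (Fin p → ℂ)) :
    reflect (l.map (factor (T k))).prod = (l.map (factor (T (-k)))).prod := by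
  induction l with
  | nil => simp
  | cons v l ih =>
    simp only [List.map_cons, List.prod_cons]
    rw [reflect_mul, ih, reflect_factor, LaurentPolynomial.invert_T]

lemma hankelRank_reflect_listProduct_le (l₁ l₂ : List (Fin p → ℂ))
    (U : Matrix (Fin p) (Fin m) ℂ) : hankelRank (reflect (listProduct l₁ l₂ U)) ≤ l₁.length := by
  rw [listProduct, reflect_mul, reflect_mul, reflect_listProd, reflect_listProd, reflect_const,
    neg_neg, Matrix.mul_assoc]
  have h1 := hankelRank_listProd_T_neg_one_mul_le l₁ ((l₂.map (factor (T 1))).prod * const U)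
  have h2 := hankelRank_listProd_T_one_mul_le l₂ (const U)
  rw [hankelRank_const] at h2
  omega

lemma isCausal_listProduct_nil (l : List (Fin p → ℂ)) (U : Matrix (Fin p) (Fin m) ℂ) :
    (listProduct [] l U).IsCausal := by
  suffices h : HasSupp (listProduct [] l U) (Set.Iic 0) from
    fun i j k hk => h i j k (by simpa using hk)
  have h1 : HasSupp (l.map (factor (T (-1)))).prod (Set.Iic 0) := by
    induction l with
    | nil =>
      rw [List.map_nil, List.prod_nil, ← const_one]
      exact (hasSupp_const 1).mono (by simp)
    | cons v l ih =>
      rw [List.map_cons, List.prod_cons]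
      exact (hasSupp_factor_T_neg_one v).mul ih Iic_add_Iic_subset
  rw [listProduct, List.map_nil, List.prod_nil, one_mul]
  exact h1.mul ((hasSupp_const U).mono (by simp)) Iic_add_Iic_subset

lemma isCausal_iff_hankelRank {F : FIR p m} : F.IsCausal ↔ hankelRank (reflect F) = 0 := by
  rw [hankelRank_eq_zero]
  constructor
  · intro h i j k hk
    simpa [reflect] using h i j (-k) (by simpa using hk)
  · intro h i j k hk
    have := h i j (-k) (by simpa using hk)
    simpa [reflect] using this

lemma det_listProd (k : ℤ) {l : List (Fin p → ℂ)} (hl : ∀ v ∈ l, star v ⬝ᵥ v = 1) :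
    (l.map (factor (T k))).prod.det = T (l.length * k) := by
  induction l with
  | nil => simp
  | cons v l ih =>
    rw [List.map_cons, List.prod_cons, Matrix.det_mul, det_factor _ (hl v List.mem_cons_self),
      ih fun w hw => hl w (List.mem_cons_of_mem v hw), ← LaurentPolynomial.T_add]
    congr 1
    push_cast [List.length_cons]
    ring

lemma det_const (U : Matrix (Fin p) (Fin p) ℂ) : (const U).det = C U.det := by
  rw [const, RingHom.map_det]; rfl

/-- In the square case the Hankel rank of a causal product is the number of its factors, as the
exponent of the determinant shows. -/
lemma hankelRank_listProduct_nil {l : List (Fin p → ℂ)} {U : Matrix (Fin p) (Fin p) ℂ}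
    (hl : ∀ v ∈ l, star v ⬝ᵥ v = 1) (hU : Uᴴ * U = 1) :
    hankelRank (listProduct [] l U) = l.length := by
  refine le_antisymm (hankelRank_listProduct_le _ _ _) ?_
  have hiso := adj_mul_self_listProduct (l₁ := []) (by simp) hl hU
  obtain ⟨l₁, l₂, V, h1, h2, h3, h4, h5, h6⟩ := exists_eq_listProduct hiso
  have h0 := isCausal_iff_hankelRank.1 (isCausal_listProduct_nil l U)
  have hl₁ : l₁ = [] := List.eq_nil_of_length_eq_zero (by omega)
  subst hl₁
  have hdet := congrArg Matrix.det h6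
  simp only [listProduct, List.map_nil, List.prod_nil, one_mul, Matrix.det_mul,
    det_listProd _ hl, det_listProd _ h2, det_const] at hdet
  have hU0 : U.det ≠ 0 := by
    intro h
    have := congrArg Matrix.det hU
    rw [Matrix.det_mul, h] at this
    simp at this
  have hcoef := congrArg (fun f => AddMonoidAlgebra.coeff f ((l.length : ℤ) * -1)) hdet
  simp only [coeff_mul_C, LaurentPolynomial.T_apply, if_true, one_mul] at hcoef
  have hlen : (l₂.length : ℤ) * -1 = (l.length : ℤ) * -1 := by
    by_contra hne
    rw [if_neg hne, zero_mul] at hcoef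
    exact hU0 hcoef
  omega

/-! ### Realizations and Hankel ranks -/

/-- A realization may be given on any finite-dimensional state space `W`, its transfer function
being described by the solutions `x` of the state equation `z x - A x = B u`. -/
lemma hasRealization_of_linearMap {W : Type*} [AddCommGroup W] [Module ℂ W]
    [FiniteDimensional ℂ W] {F : FIR p m} (A : W →ₗ[ℂ] W) (B : (Fin m → ℂ) →ₗ[ℂ] W)
    (Γ : W →ₗ[ℂ] (Fin p → ℂ)) (D : Matrix (Fin p) (Fin m) ℂ)
    (h : ∀ z : ℂ, z ≠ 0 → ∀ u, ∃ x, z • x - A x = B u ∧ F.eval z *ᵥ u = Γ x + D *ᵥ u) :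
    F.HasRealization (Module.finrank ℂ W) := by
  let b := Module.finBasis ℂ W
  refine ⟨LinearMap.toMatrix b b A, LinearMap.toMatrix (Pi.basisFun ℂ (Fin m)) b B,
    LinearMap.toMatrix b (Pi.basisFun ℂ (Fin p)) Γ, D, fun z hz hu => ?_⟩
  apply Matrix.toLin'.injective
  refine LinearMap.ext fun u => ?_
  obtain ⟨x, hx, hF⟩ := h z hz u
  have hB : LinearMap.toMatrix (Pi.basisFun ℂ (Fin m)) b B *ᵥ u = b.repr (B u) := by
    rw [← LinearMap.toMatrix_mulVec_repr (Pi.basisFun ℂ (Fin m)) b B u]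
    rfl
  have hC : LinearMap.toMatrix b (Pi.basisFun ℂ (Fin p)) Γ *ᵥ b.repr x = Γ x := by
    have := LinearMap.toMatrix_mulVec_repr b (Pi.basisFun ℂ (Fin p)) Γ x
    rw [this]; rfl
  have hA : (z • (1 : Matrix _ _ ℂ) - LinearMap.toMatrix b b A) *ᵥ b.repr x = b.repr (B u) := by
    rw [Matrix.sub_mulVec, Matrix.smul_mulVec, Matrix.one_mulVec,
      LinearMap.toMatrix_mulVec_repr, ← hx, map_sub, map_smul]
    rfl
  have hdet := (Matrix.isUnit_iff_isUnit_det _).1 hu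
  have hinv : (z • (1 : Matrix _ _ ℂ) - LinearMap.toMatrix b b A)⁻¹ *ᵥ b.repr (B u) =
      b.repr x := by
    rw [← hA, Matrix.mulVec_mulVec, Matrix.nonsing_inv_mul _ hdet, Matrix.one_mulVec]
  rw [Matrix.toLin'_apply, Matrix.toLin'_apply, hF, Matrix.add_mulVec, ← Matrix.mulVec_mulVec,
    ← Matrix.mulVec_mulVec, hB, hinv, hC]

lemma coeff_shift_pow (j : ℕ) (y : Fin p → ℂ[T;T⁻¹]) (i : Fin p) {k : ℤ} (hk : k < 0) :
    ((shift ^ j) y i).coeff k = (y i).coeff (k - j) := by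
  induction j generalizing k with
  | zero => simp
  | succ j ih =>
    rw [pow_succ', Module.End.mul_apply, coeff_shift, if_pos hk, ih (by omega)]
    congr 1
    push_cast
    ring

lemma coeff_mulVec_mono (F : FIR p m) (j : ℤ) (a : Fin m → ℂ) (i : Fin p) (k : ℤ) :
    ((F *ᵥ mono j a) i).coeff k = ∑ l, (F i l).coeff (k - j) * a l := by
  simp only [Matrix.mulVec, dotProduct, AddMonoidAlgebra.coeff_sum, Finsupp.coe_finsetSum,
    Finset.sum_apply, mono]
  refine Finset.sum_congr rfl fun l _ => ?_
  rw [← mul_assoc, coeff_mul_T, coeff_mul_C]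

/-- The map `a ↦ a z ^ k`. -/
def monoLin (k : ℤ) : (Fin m → ℂ) →ₗ[ℂ] (Fin m → ℂ[T;T⁻¹]) where
  toFun := mono k
  map_add' a b := by funext i; simp [mono, add_mul]
  map_smul' c a := mono_smul k c a

/-- A causal FIR is realized on its Hankel space, with the shift as state operator. -/
lemma hasRealization_hankelRank {F : FIR p m} (hF : F.IsCausal) :
    F.HasRealization (hankelRank F) := by
  obtain ⟨K, hK⟩ := exists_hasSupp_Ici F
  let A : hankelSpace F →ₗ[ℂ] hankelSpace F :=
    shift.restrict fun y hy => shift_mem_hankelSpace hy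
  let B : (Fin m → ℂ) →ₗ[ℂ] hankelSpace F :=
    LinearMap.codRestrict _ (negMul F ∘ₗ monoLin 0) fun u =>
      ⟨mono 0 u, mono_mem (by simp) u, rfl⟩
  let Γ : hankelSpace F →ₗ[ℂ] (Fin p → ℂ) :=
    { toFun := fun y i => (y.1 i).coeff (-1)
      map_add' := by intro f g; ext; simp
      map_smul' := by intro c f; ext; simp }
  refine hasRealization_of_linearMap A B Γ (Matrix.of fun i j => (F i j).coeff 0)
    fun z hz u => ?_
  have hApow : ∀ (j : ℕ) (y : hankelSpace F), ((A ^ j) y).1 = (shift ^ j) y.1 := by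
    intro j
    induction j with
    | zero => intro y; rfl
    | succ j ih =>
      intro y
      rw [pow_succ', pow_succ', Module.End.mul_apply, Module.End.mul_apply, ← ih]
      rfl
  have hB : ∀ i, ∀ k < 0, ((B u).1 i).coeff k = ∑ l, (F i l).coeff k * u l := by
    intro i k hk
    change (negPart (F *ᵥ mono 0 u) i).coeff k = _
    rw [coeff_negPart, if_pos hk, coeff_mulVec_mono, sub_zero]
  have hnil : (A ^ K) (B u) = 0 := by
    apply Subtype.ext
    rw [hApow]
    ext i k
    by_cases hk : k < 0
    · rw [coeff_shift_pow K _ i hk, hB i _ (by omega)]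
      refine Finset.sum_eq_zero fun l _ => ?_
      rw [hK i l _ (by simp only [Set.mem_Ici, not_le]; omega), zero_mul]
    · have : (shift ^ K) (B u).1 ∈ supp p (Set.Iio 0) := by
        rw [← hApow]; exact hankelSpace_le_neg F ((A ^ K) (B u)).2
      exact this i k (by simpa using hk)
  -- the Neumann series of `(z - A)⁻¹ B u`, finite as `A` is nilpotent on `B u`
  refine ⟨∑ k ∈ Finset.range K, (z⁻¹) ^ (k + 1) • (A ^ k) (B u), ?_, ?_⟩
  · have h1 : z • ∑ k ∈ Finset.range K, (z⁻¹) ^ (k + 1) • (A ^ k) (B u) -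
        A (∑ k ∈ Finset.range K, (z⁻¹) ^ (k + 1) • (A ^ k) (B u)) =
        ∑ k ∈ Finset.range K, ((z⁻¹) ^ k • (A ^ k) (B u) -
          (z⁻¹) ^ (k + 1) • (A ^ (k + 1)) (B u)) := by
      rw [Finset.smul_sum, map_sum, ← Finset.sum_sub_distrib]
      refine Finset.sum_congr rfl fun k _ => ?_
      rw [map_smul, smul_smul, pow_succ', mul_inv_cancel_left₀ hz, pow_succ' A,
        Module.End.mul_apply]
    rw [h1, Finset.sum_range_sub', hnil]
    simp
  · funext i
    rw [Pi.add_apply]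
    have hev : ∀ l, F.eval z i l = (F i l).coeff 0 +
        ∑ k ∈ Finset.range K, (F i l).coeff (-(k + 1 : ℕ)) * (z⁻¹) ^ (k + 1) := by
      intro l
      have hs : ∀ k ∉ (Finset.range (K + 1)).image (fun k : ℕ => -(k : ℤ)),
          (F i l).coeff k = 0 := by
        intro k hk
        by_cases hk0 : 0 < k
        · exact hF i l k hk0
        · refine hK i l k fun hk' => hk ?_
          simp only [Set.mem_Ici] at hk'
          exact Finset.mem_image.2 ⟨k.natAbs, by simp only [Finset.mem_range]; omega, by omega⟩
      rw [eval, Matrix.map_apply, evalScalar_eq_sum _ hs, Finset.sum_image (by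
        intro a _ b _ hab; simpa using hab), Finset.sum_range_succ']
      rw [add_comm]
      congr 1
      · simp
      · refine Finset.sum_congr rfl fun k _ => ?_
        rw [zpow_neg, zpow_natCast, inv_pow]
    have hΓ : Γ (∑ k ∈ Finset.range K, (z⁻¹) ^ (k + 1) • (A ^ k) (B u)) i =
        ∑ k ∈ Finset.range K, (z⁻¹) ^ (k + 1) * ∑ l, (F i l).coeff (-(k + 1 : ℕ)) * u l := by
      rw [map_sum, Finset.sum_apply]
      refine Finset.sum_congr rfl fun k _ => ?_
      rw [map_smul, Pi.smul_apply, smul_eq_mul]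
      congr 1
      change (((A ^ k) (B u)).1 i).coeff (-1) = _
      rw [hApow, coeff_shift_pow _ _ _ (by omega), hB _ _ (by omega)]
      have : (-1 : ℤ) - k = -(k + 1 : ℕ) := by push_cast; ring
      rw [this]
    rw [hΓ]
    simp only [Matrix.mulVec, dotProduct, hev, add_mul, Finset.sum_add_distrib, Matrix.of_apply,
      Finset.sum_mul, Finset.mul_sum]
    rw [add_comm, Finset.sum_comm]
    congr 1
    exact Finset.sum_congr rfl fun k _ => Finset.sum_congr rfl fun l _ => by ring

open Filter Topology Bornology in
lemma tendsto_evalScalar {f : ℂ[T;T⁻¹]} (hf : ∀ k : ℤ, 0 < k → f.coeff k = 0) :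
    Tendsto (evalScalar f) (cobounded ℂ) (𝓝 (f.coeff 0)) := by
  have h1 : evalScalar f = fun z => ∑ k ∈ insert 0 f.coeff.support, f.coeff k * z ^ k := by
    funext z
    exact evalScalar_eq_sum f (fun k hk => by
      simp only [Finset.mem_insert, Finsupp.mem_support_iff, not_or, not_not] at hk
      exact hk.2) z
  have h2 : f.coeff 0 = ∑ k ∈ insert 0 f.coeff.support, if k = 0 then f.coeff 0 else 0 := by
    rw [Finset.sum_ite_eq' _ (0 : ℤ) fun _ => f.coeff 0]
    simp
  rw [h1, h2]
  refine tendsto_finsetSum _ fun k _ => ?_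
  rcases lt_trichotomy k 0 with hk | rfl | hk
  · rw [if_neg hk.ne]
    obtain ⟨n, rfl⟩ : ∃ n : ℕ, k = -((n + 1 : ℕ) : ℤ) := ⟨(-k - 1).toNat, by omega⟩
    have h3 : Tendsto (fun z : ℂ => (z⁻¹) ^ (n + 1)) (cobounded ℂ) (𝓝 0) := by
      simpa using (tendsto_inv₀_cobounded (α := ℂ)).pow (n + 1)
    simp only [zpow_neg, zpow_natCast, ← inv_pow]
    simpa using h3.const_mul (f.coeff (-((n + 1 : ℕ) : ℤ)))
  · simp
  · rw [hf k hk, if_neg hk.ne']; simp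

section Resolvent

attribute [local instance] Matrix.linftyOpNormedRing Matrix.linftyOpNormedAlgebra

open Filter Topology Bornology in
lemma tendsto_matrix_resolvent {ν : ℕ} (A : Matrix (Fin ν) (Fin ν) ℂ) :
    Tendsto (fun z : ℂ => (z • (1 : Matrix (Fin ν) (Fin ν) ℂ) - A)⁻¹) (cobounded ℂ) (𝓝 0) := by
  have : CompleteSpace (Matrix (Fin ν) (Fin ν) ℂ) := FiniteDimensional.complete ℂ _
  have h := spectrum.resolvent_tendsto_cobounded (𝕜 := ℂ) A
  refine h.congr fun z => ?_
  rw [resolvent, Algebra.algebraMap_eq_smul_one, Matrix.nonsing_inv_eq_ringInverse]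

open Filter Topology Bornology in
lemma eventually_isUnit_sub {ν : ℕ} (A : Matrix (Fin ν) (Fin ν) ℂ) :
    ∀ᶠ z : ℂ in cobounded ℂ, z ≠ 0 ∧ IsUnit (z • (1 : Matrix (Fin ν) (Fin ν) ℂ) - A) := by
  have h := spectrum.eventually_isUnit_resolvent (𝕜 := ℂ) A
  filter_upwards [h, eventually_ne_cobounded 0] with z hz h0
  refine ⟨h0, ?_⟩
  rw [← spectrum.isUnit_resolvent, spectrum.mem_resolventSet_iff,
    Algebra.algebraMap_eq_smul_one] at hz
  exact hz

end Resolvent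

open Filter Topology Bornology in
/-- The constant term of a realization is the value at infinity. -/
lemma coeff_zero_of_realization {F : FIR p m} (hF : F.IsCausal) {ν : ℕ}
    {A : Matrix (Fin ν) (Fin ν) ℂ} {B : Matrix (Fin ν) (Fin m) ℂ} {Γ : Matrix (Fin p) (Fin ν) ℂ}
    {D : Matrix (Fin p) (Fin m) ℂ}
    (h : ∀ z : ℂ, z ≠ 0 → IsUnit (z • (1 : Matrix (Fin ν) (Fin ν) ℂ) - A) →
      F.eval z = Γ * (z • (1 : Matrix (Fin ν) (Fin ν) ℂ) - A)⁻¹ * B + D) (i : Fin p)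
    (j : Fin m) : (F i j).coeff 0 = D i j := by
  have h1 := tendsto_evalScalar (hF i j)
  have h2 : Tendsto (fun z : ℂ => (Γ * (z • (1 : Matrix (Fin ν) (Fin ν) ℂ) - A)⁻¹ * B + D) i j)
      (cobounded ℂ) (𝓝 (D i j)) := by
    have h3 : Tendsto (fun z : ℂ => Γ * (z • (1 : Matrix (Fin ν) (Fin ν) ℂ) - A)⁻¹ * B + D)
        (cobounded ℂ) (𝓝 (Γ * (0 : Matrix (Fin ν) (Fin ν) ℂ) * B + D)) := by
      have hc : Continuous fun X : Matrix (Fin ν) (Fin ν) ℂ => Γ * X * B + D := by fun_prop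
      exact (hc.tendsto 0).comp (tendsto_matrix_resolvent A)
    have h4 := (tendsto_pi_nhds.1 ((tendsto_pi_nhds.1 h3) i)) j
    simpa using h4
  refine tendsto_nhds_unique h1 (h2.congr' ?_)
  filter_upwards [eventually_isUnit_sub A] with z hz
  rw [← h z hz.1 hz.2]
  rfl

/-- If `F` has the realization `A, B, C, D`, then `z (F(z) - D)` is causal and has the realization
`A, A B, C, C B`. -/
lemma exists_shifted_realization {F : FIR p m} (hF : F.IsCausal) {ν : ℕ}
    {A : Matrix (Fin ν) (Fin ν) ℂ} {B : Matrix (Fin ν) (Fin m) ℂ} {Γ : Matrix (Fin p) (Fin ν) ℂ}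
    {D : Matrix (Fin p) (Fin m) ℂ}
    (h : ∀ z : ℂ, z ≠ 0 → IsUnit (z • (1 : Matrix (Fin ν) (Fin ν) ℂ) - A) →
      F.eval z = Γ * (z • (1 : Matrix (Fin ν) (Fin ν) ℂ) - A)⁻¹ * B + D) :
    ∃ F' : FIR p m, F'.IsCausal ∧
      (∀ i j, ∀ l ≤ 0, (F' i j).coeff l = (F i j).coeff (l - 1)) ∧
      ∀ z : ℂ, z ≠ 0 → IsUnit (z • (1 : Matrix (Fin ν) (Fin ν) ℂ) - A) →
        F'.eval z = Γ * (z • (1 : Matrix (Fin ν) (Fin ν) ℂ) - A)⁻¹ * (A * B) + Γ * B := by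
  have hD := coeff_zero_of_realization hF h
  set F' : FIR p m := (T 1 : ℂ[T;T⁻¹]) • (F - const D) with hF'
  have hcoef : ∀ i j l, (F' i j).coeff l =
      (F i j).coeff (l - 1) - if l - 1 = 0 then D i j else 0 := by
    intro i j l
    simp only [hF', Matrix.smul_apply, Matrix.sub_apply, smul_eq_mul, coeff_T_mul,
      AddMonoidAlgebra.coeff_sub, Finsupp.sub_apply, const, Matrix.map_apply,
      LaurentPolynomial.C_apply]
  refine ⟨F', fun i j l hl => ?_, fun i j l hl => ?_, fun z hz hu => ?_⟩
  · rw [hcoef]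
    by_cases h1 : l - 1 = 0
    · rw [if_pos h1, h1, hD, sub_self]
    · rw [if_neg h1, hF i j _ (by omega), sub_zero]
  · rw [hcoef, if_neg (by omega), sub_zero]
  · have hdet := (Matrix.isUnit_iff_isUnit_det _).1 hu
    have h1 : F'.eval z = z • (F.eval z - D) := by
      ext i j
      simp only [hF', eval, Matrix.map_apply, Matrix.smul_apply, Matrix.sub_apply, smul_eq_mul,
        const, evalScalar_eq_eval₂ _ hz, map_mul, map_sub]
      simp
    set R := (z • (1 : Matrix (Fin ν) (Fin ν) ℂ) - A)⁻¹ with hR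
    have h2 : R * A = z • R - 1 := by
      have h3 : R * (z • (1 : Matrix (Fin ν) (Fin ν) ℂ) - A) = 1 := Matrix.nonsing_inv_mul _ hdet
      rw [mul_sub, Matrix.mul_smul, mul_one] at h3
      rw [← h3]; abel
    rw [h1, h z hz hu, add_sub_cancel_right, ← Matrix.mul_assoc, Matrix.mul_assoc Γ R A, h2,
      Matrix.mul_sub, Matrix.sub_mul, Matrix.mul_one, sub_add_cancel, Matrix.mul_smul,
      Matrix.smul_mul]

/-- The coefficients of `F` are the Markov parameters of its realizations. -/
lemma coeff_of_realization (k : ℕ) {F : FIR p m} (hF : F.IsCausal) {ν : ℕ}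
    {A : Matrix (Fin ν) (Fin ν) ℂ} {B : Matrix (Fin ν) (Fin m) ℂ} {Γ : Matrix (Fin p) (Fin ν) ℂ}
    {D : Matrix (Fin p) (Fin m) ℂ}
    (h : ∀ z : ℂ, z ≠ 0 → IsUnit (z • (1 : Matrix (Fin ν) (Fin ν) ℂ) - A) →
      F.eval z = Γ * (z • (1 : Matrix (Fin ν) (Fin ν) ℂ) - A)⁻¹ * B + D) (i : Fin p)
    (j : Fin m) : (F i j).coeff (-(k : ℤ) - 1) = (Γ * (A ^ k * B)) i j := by
  obtain ⟨F', hcausal, hcoef, hreal⟩ := exists_shifted_realization hF h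
  induction k generalizing F F' B D with
  | zero =>
    rw [← hcoef i j _ (by simp), Nat.cast_zero, neg_zero,
      coeff_zero_of_realization hcausal hreal, pow_zero, Matrix.one_mul]
  | succ k ih =>
    obtain ⟨F'', hcausal', hcoef', hreal'⟩ := exists_shifted_realization hcausal hreal
    rw [← hcoef i j _ (by omega), pow_succ, Matrix.mul_assoc, ← ih hcausal hreal F'' hcausal' hcoef'
      hreal']
    congr 1
    push_cast
    ring

/-- A property stable under linear combinations holds on `supp m s` as soon as it holds for the
vectors `a z ^ k`, `k` in `s`. -/
lemma supp_le_of_mono_mem {s : Set ℤ} {S : Submodule ℂ (Fin m → ℂ[T;T⁻¹])}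
    (h : ∀ k ∈ s, ∀ a, mono k a ∈ S) : supp m s ≤ S := by
  intro f hf
  set t : Finset ℤ := Finset.univ.biUnion fun i => (f i).coeff.support with ht
  have hsum : f = ∑ k ∈ t, mono k fun i => (f i).coeff k := by
    ext i l
    rw [Finset.sum_apply, AddMonoidAlgebra.coeff_sum, Finsupp.coe_finsetSum, Finset.sum_apply]
    simp only [coeff_mono, Finset.sum_ite_eq']
    split_ifs with hl
    · rfl
    · by_contra h0
      exact hl (Finset.mem_biUnion.2 ⟨i, Finset.mem_univ i, Finsupp.mem_support_iff.2 h0⟩)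
  rw [hsum]
  refine Submodule.sum_mem _ fun k hk => h k ?_ _
  obtain ⟨i, -, hi⟩ := Finset.mem_biUnion.1 hk
  by_contra hks
  exact Finsupp.mem_support_iff.1 hi (hf i k hks)

/-- The Hankel operator of `F` factors through the state space of any realization. -/
lemma hankelRank_le_of_hasRealization {F : FIR p m} (hF : F.IsCausal) {ν : ℕ}
    (h : F.HasRealization ν) : hankelRank F ≤ ν := by
  obtain ⟨A, B, Γ, D, hreal⟩ := h
  have hmarkov := fun k => coeff_of_realization k hF hreal
  let ψ : (Fin p → ℂ[T;T⁻¹]) →ₗ[ℂ] (ℕ → Fin p → ℂ) :=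
    { toFun := fun f k i => (f i).coeff (-(k : ℤ) - 1)
      map_add' := by intro f g; ext; simp
      map_smul' := by intro c f; ext; simp }
  let O : (Fin ν → ℂ) →ₗ[ℂ] (ℕ → Fin p → ℂ) :=
    LinearMap.pi fun k => Matrix.mulVecLin (Γ * A ^ k)
  have hle : (hankelSpace F).map ψ ≤ LinearMap.range O := by
    rw [hankelSpace, ← Submodule.map_comp, Submodule.map_le_iff_le_comap]
    refine supp_le_of_mono_mem fun k hk a => ?_
    obtain ⟨j, rfl⟩ := Int.eq_ofNat_of_zero_le hk
    refine ⟨A ^ j *ᵥ (B *ᵥ a), ?_⟩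
    funext k i
    change ((Γ * A ^ k) *ᵥ (A ^ j *ᵥ (B *ᵥ a))) i =
      (negPart (F *ᵥ mono j a) i).coeff (-(k : ℤ) - 1)
    rw [coeff_negPart, if_pos (by omega), coeff_mulVec_mono, Matrix.mulVec_mulVec,
      Matrix.mulVec_mulVec, Matrix.mul_assoc Γ, ← pow_add, Matrix.mul_assoc]
    change ∑ l, (Γ * (A ^ (k + j) * B)) i l * a l = _
    refine Finset.sum_congr rfl fun l _ => ?_
    rw [← hmarkov]
    congr 2
    push_cast
    ring
  have hinj : Function.Injective (ψ.domRestrict (hankelSpace F)) := by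
    rw [injective_iff_map_eq_zero]
    intro y hy
    apply Subtype.ext
    ext i k
    by_cases hk : k < 0
    · have := congrFun (congrFun hy (-k - 1).toNat) i
      have h2 : -((-k - 1).toNat : ℤ) - 1 = k := by omega
      change (y.1 i).coeff (-((-k - 1).toNat : ℤ) - 1) = 0 at this
      rw [h2] at this
      simpa using this
    · exact hankelSpace_le_neg F y.2 i k (by simpa using hk)
  calc hankelRank F = Module.finrank ℂ (LinearMap.range (ψ.domRestrict (hankelSpace F))) :=
        (LinearMap.finrank_range_of_inj hinj).symm
    _ = Module.finrank ℂ ((hankelSpace F).map ψ) := by rw [LinearMap.range_domRestrict]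
    _ ≤ Module.finrank ℂ (LinearMap.range O) := Submodule.finrank_mono hle
    _ ≤ ν := by
      have := LinearMap.finrank_range_le O
      rwa [Module.finrank_fin_fun] at this

/-- For causal FIRs the smallest size of a realization is the Hankel rank. -/
theorem minRealizationSize_eq_hankelRank {F : FIR p m} (hF : F.IsCausal) :
    F.minRealizationSize = hankelRank F :=
  le_antisymm (Nat.sInf_le (hasRealization_hankelRank hF))
    (le_csInf ⟨_, hasRealization_hankelRank hF⟩ fun _ h => hankelRank_le_of_hasRealization hF h)

lemma coeff_causalPart (F : FIR p m) (i : Fin p) (j : Fin m) (k : ℤ) :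
    (F.causalPart i j).coeff k = if k ≤ 0 then (F i j).coeff k else 0 := by
  simp [causalPart, Finsupp.filter_apply]

lemma coeff_reflect_strictlyAnticausalPart (F : FIR p m) (i : Fin p) (j : Fin m) (k : ℤ) :
    (F.strictlyAnticausalPart.reflect i j).coeff k =
      if k < 0 then (F.reflect i j).coeff k else 0 := by
  simp [strictlyAnticausalPart, reflect, Finsupp.filter_apply]

/-- The McMillan degree is the sum of the ranks of the two Hankel operators. -/
theorem mcMillanDegree_eq (F : FIR p m) :
    F.mcMillanDegree = hankelRank F + hankelRank F.reflect := by
  have h1 : F.causalPart.IsCausal := fun i j k hk => by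
    rw [coeff_causalPart, if_neg (not_le.2 hk)]
  have h2 : F.strictlyAnticausalPart.reflect.IsCausal := fun i j k hk => by
    rw [coeff_reflect_strictlyAnticausalPart, if_neg (not_lt.2 hk.le)]
  have h3 : hankelSpace F.causalPart = hankelSpace F := hankelSpace_congr fun i j k hk => by
    simp only [Set.mem_Ici, not_le] at hk
    rw [Matrix.sub_apply, AddMonoidAlgebra.coeff_sub, Finsupp.sub_apply, coeff_causalPart,
      if_pos hk.le, sub_self]
  have h4 : hankelSpace F.strictlyAnticausalPart.reflect = hankelSpace F.reflect :=
    hankelSpace_congr fun i j k hk => by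
      simp only [Set.mem_Ici, not_le] at hk
      rw [Matrix.sub_apply, AddMonoidAlgebra.coeff_sub, Finsupp.sub_apply,
        coeff_reflect_strictlyAnticausalPart, if_pos hk, sub_self]
  rw [mcMillanDegree, minRealizationSize_eq_hankelRank h1, minRealizationSize_eq_hankelRank h2]
  congr 1
  · rw [hankelRank, h3, hankelRank]
  · rw [hankelRank, h4, hankelRank]

lemma HasRealization.transpose {F : FIR p m} {ν : ℕ} (h : F.HasRealization ν) :
    HasRealization (Fᵀ : FIR m p) ν := by
  obtain ⟨A, B, Γ, D, h⟩ := h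
  refine ⟨Aᵀ, Γᵀ, Bᵀ, Dᵀ, fun z hz hu => ?_⟩
  have ht : (z • (1 : Matrix (Fin ν) (Fin ν) ℂ) - A)ᵀ = z • (1 : Matrix _ _ ℂ) - Aᵀ := by
    rw [Matrix.transpose_sub, Matrix.transpose_smul, Matrix.transpose_one]
  rw [← ht] at hu ⊢
  rw [← Matrix.transpose_nonsing_inv, ← Matrix.transpose_mul, ← Matrix.transpose_mul,
    ← Matrix.transpose_add, ← Matrix.mul_assoc, ← h z hz ((Matrix.isUnit_transpose _).1 hu)]
  rfl

lemma minRealizationSize_transpose (F : FIR p m) :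
    minRealizationSize (Fᵀ : FIR m p) = F.minRealizationSize := by
  have h : {ν | HasRealization (Fᵀ : FIR m p) ν} = {ν | F.HasRealization ν} :=
    Set.ext fun ν => ⟨fun h => by simpa using HasRealization.transpose h, HasRealization.transpose⟩
  rw [minRealizationSize, h, minRealizationSize]

theorem mcMillanDegree_transpose (F : FIR p m) :
    mcMillanDegree (Fᵀ : FIR m p) = F.mcMillanDegree := by
  rw [mcMillanDegree, mcMillanDegree, ← minRealizationSize_transpose F.causalPart,
    ← minRealizationSize_transpose F.strictlyAnticausalPart.reflect]
  rfl

/-! ### Trigonometric polynomials -/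

variable {N : ℕ}

lemma IsTrigPoly.const (c : ℂ) : IsTrigPoly fun _ : Fin N → ℝ => c :=
  Subalgebra.algebraMap_mem _ c

lemma IsTrigPoly.cos (i : Fin N) : IsTrigPoly fun θ : Fin N → ℝ => (Real.cos (θ i) : ℂ) :=
  Algebra.subset_adjoin (Or.inl ⟨i, rfl⟩)

lemma IsTrigPoly.sin (i : Fin N) : IsTrigPoly fun θ : Fin N → ℝ => (Real.sin (θ i) : ℂ) :=
  Algebra.subset_adjoin (Or.inr ⟨i, rfl⟩)

lemma IsTrigPoly.add {f g : (Fin N → ℝ) → ℂ} (hf : IsTrigPoly f) (hg : IsTrigPoly g) :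
    IsTrigPoly fun θ => f θ + g θ :=
  Subalgebra.add_mem _ hf hg

lemma IsTrigPoly.mul {f g : (Fin N → ℝ) → ℂ} (hf : IsTrigPoly f) (hg : IsTrigPoly g) :
    IsTrigPoly fun θ => f θ * g θ :=
  Subalgebra.mul_mem _ hf hg

lemma IsTrigPoly.neg {f : (Fin N → ℝ) → ℂ} (hf : IsTrigPoly f) : IsTrigPoly fun θ => -f θ :=
  Subalgebra.neg_mem _ hf

lemma IsTrigPoly.sum {ι : Type*} {s : Finset ι} {f : ι → (Fin N → ℝ) → ℂ}
    (hf : ∀ i ∈ s, IsTrigPoly (f i)) : IsTrigPoly fun θ => ∑ i ∈ s, f i θ := by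
  have h := Subalgebra.sum_mem _ hf
  have h2 : (fun θ => ∑ i ∈ s, f i θ) = ∑ i ∈ s, f i := by funext θ; simp
  rw [IsTrigPoly, h2]
  exact h

/-- Trigonometric polynomials remain so when angles are renamed or added. -/
lemma IsTrigPoly.comp {M : ℕ} {f : (Fin N → ℝ) → ℂ} (hf : IsTrigPoly f) (e : Fin N → Fin M) :
    IsTrigPoly fun θ : Fin M → ℝ => f fun i => θ (e i) := by
  refine Algebra.adjoin_induction
    (p := fun f _ => IsTrigPoly fun θ : Fin M → ℝ => f fun i => θ (e i)) ?_ ?_ ?_ ?_ hf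
  · rintro _ (⟨i, rfl⟩ | ⟨i, rfl⟩)
    · exact IsTrigPoly.cos (e i)
    · exact IsTrigPoly.sin (e i)
  · exact fun c => IsTrigPoly.const c
  · exact fun _ _ _ _ hf hg => hf.add hg
  · exact fun _ _ _ _ hf hg => hf.mul hg

lemma IsTrigPoly.matrix_mul {q : ℕ} {A : (Fin N → ℝ) → Matrix (Fin p) (Fin q) ℂ}
    {B : (Fin N → ℝ) → Matrix (Fin q) (Fin m) ℂ} (hA : ∀ i j, IsTrigPoly fun θ => A θ i j)
    (hB : ∀ i j, IsTrigPoly fun θ => B θ i j) (i : Fin p) (j : Fin m) :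
    IsTrigPoly fun θ => (A θ * B θ) i j := by
  simp only [Matrix.mul_apply]
  exact IsTrigPoly.sum fun k _ => (hA i k).mul (hB k j)

/-! ### Parametrization of unit vectors -/

lemma exists_angle {c : ℂ} (hc : ‖c‖ = 1) :
    ∃ β ∈ Set.Ico 0 (2 * Real.pi), (Real.cos β : ℂ) + Real.sin β * Complex.I = c := by
  have h2π : 0 < 2 * Real.pi := by positivity
  refine ⟨toIcoMod h2π 0 c.arg, by simpa using toIcoMod_mem_Ico h2π 0 c.arg, ?_⟩
  rw [toIcoMod, zsmul_eq_mul, Real.cos_sub_int_mul_two_pi, Real.sin_sub_int_mul_two_pi]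
  have h := Complex.norm_mul_cos_add_sin_mul_I c
  rw [hc, Complex.ofReal_one, one_mul] at h
  rw [Complex.ofReal_cos, Complex.ofReal_sin, h]

/-- The block matrix `1 ⊕ X`. -/
def oneSum (X : Matrix (Fin p) (Fin m) ℂ) : Matrix (Fin (p + 1)) (Fin (m + 1)) ℂ :=
  Matrix.of (Fin.cons (Fin.cons 1 0) fun i => Fin.cons 0 (X i))

@[simp] lemma oneSum_zero_zero (X : Matrix (Fin p) (Fin m) ℂ) : oneSum X 0 0 = 1 := rfl

@[simp] lemma oneSum_zero_succ (X : Matrix (Fin p) (Fin m) ℂ) (j : Fin m) :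
    oneSum X 0 j.succ = 0 := rfl

@[simp] lemma oneSum_succ_zero (X : Matrix (Fin p) (Fin m) ℂ) (i : Fin p) :
    oneSum X i.succ 0 = 0 := rfl

@[simp] lemma oneSum_succ_succ (X : Matrix (Fin p) (Fin m) ℂ) (i : Fin p) (j : Fin m) :
    oneSum X i.succ j.succ = X i j := rfl

lemma conjTranspose_oneSum_mul_self (X : Matrix (Fin p) (Fin m) ℂ) :
    (oneSum X)ᴴ * oneSum X = oneSum (Xᴴ * X) := by
  ext i j
  refine Fin.cases ?_ (fun i => ?_) i <;> refine Fin.cases ?_ (fun j => ?_) j <;>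
    simp [Matrix.mul_apply, Fin.sum_univ_succ]

lemma oneSum_one : oneSum (1 : Matrix (Fin p) (Fin p) ℂ) = 1 := by
  ext i j
  refine Fin.cases ?_ (fun i => ?_) i <;> refine Fin.cases ?_ (fun j => ?_) j <;>
    simp [Matrix.one_apply, Fin.succ_ne_zero, (Fin.succ_ne_zero _).symm]

lemma oneSum_injective :
    Function.Injective
      (oneSum : Matrix (Fin p) (Fin m) ℂ → Matrix (Fin (p + 1)) (Fin (m + 1)) ℂ) := by
  intro X Y h
  ext i j
  simpa using congrFun (congrFun h i.succ) j.succ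

lemma IsTrigPoly.oneSum {X : (Fin N → ℝ) → Matrix (Fin p) (Fin m) ℂ}
    (hX : ∀ i j, IsTrigPoly fun θ => X θ i j) (i : Fin (p + 1)) (j : Fin (m + 1)) :
    IsTrigPoly fun θ => oneSum (X θ) i j := by
  refine Fin.cases ?_ (fun i => ?_) i <;> refine Fin.cases ?_ (fun j => ?_) j
  · exact IsTrigPoly.const 1
  · exact IsTrigPoly.const 0
  · exact IsTrigPoly.const 0
  · exact hX i j

/-- The rotation with cosine `c` and sine `s` in the plane of the first two coordinates. -/
def rotation (p : ℕ) (c s : ℂ) : Matrix (Fin (p + 2)) (Fin (p + 2)) ℂ :=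
  Matrix.of (Fin.cons (Fin.cons c (Fin.cons (-s) 0)) (Fin.cons (Fin.cons s (Fin.cons c 0))
    fun i => Fin.cons 0 (Fin.cons 0 ((1 : Matrix (Fin p) (Fin p) ℂ) i))))

lemma conjTranspose_rotation_mul_self (α : ℝ) :
    (rotation p (Real.cos α) (Real.sin α))ᴴ * rotation p (Real.cos α) (Real.sin α) = 1 := by
  have h : (Real.cos α : ℂ) * Real.cos α + Real.sin α * Real.sin α = 1 := by
    have := Real.cos_sq_add_sin_sq α
    rw [← Complex.ofReal_mul, ← Complex.ofReal_mul, ← Complex.ofReal_add, ← sq, ← sq, this,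
      Complex.ofReal_one]
  have h0 : ∀ j : Fin p, (0 : Fin (p + 2)) ≠ j.succ.succ := fun j => (Fin.succ_ne_zero _).symm
  have h1 : ∀ j : Fin p, (1 : Fin (p + 2)) ≠ j.succ.succ := fun j hj => by
    simpa using congrArg Fin.val hj
  have h1' : ∀ j : Fin p, j.succ.succ ≠ (1 : Fin (p + 2)) := fun j => (h1 j).symm
  ext i j
  refine Fin.cases ?_ (Fin.cases ?_ fun i => ?_) i <;>
    refine Fin.cases ?_ (Fin.cases ?_ fun j => ?_) j <;>
    simp [Matrix.mul_apply, Fin.sum_univ_succ, rotation, Matrix.one_apply, -Complex.ofReal_cos,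
      -Complex.ofReal_sin, h, h0, h1, h1', mul_comm, add_comm]
  simp only [eq_comm]

lemma IsTrigPoly.rotation {c s : (Fin N → ℝ) → ℂ} (hc : IsTrigPoly c) (hs : IsTrigPoly s)
    (i j : Fin (p + 2)) : IsTrigPoly fun θ => rotation p (c θ) (s θ) i j := by
  refine Fin.cases ?_ (Fin.cases ?_ fun i => ?_) i <;>
    refine Fin.cases ?_ (Fin.cases ?_ fun j => ?_) j
  exacts [hc, hs.neg, IsTrigPoly.const 0, hs, hc, IsTrigPoly.const 0, IsTrigPoly.const 0,
    IsTrigPoly.const 0, IsTrigPoly.const _]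

lemma snoc_mem_angleCube {θ : Fin N → ℝ} (hθ : θ ∈ angleCube N) {β : ℝ}
    (hβ : β ∈ Set.Ico 0 (2 * Real.pi)) :
    (Fin.snoc θ β : Fin (N + 1) → ℝ) ∈ angleCube (N + 1) := by
  intro i
  refine Fin.lastCases ?_ (fun i => ?_) i
  · simpa using hβ
  · simpa using hθ i

/-- A unit vector of `ℂ ^ (p + 2)` is `c (cos α, y sin α)` with `|c| = 1`, `y` a unit vector. -/
lemma exists_polar {x : Fin (p + 2) → ℂ} (hx : ∑ i, ‖x i‖ ^ 2 = 1) :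
    ∃ c : ℂ, ‖c‖ = 1 ∧ ∃ α ∈ Set.Ico 0 (2 * Real.pi), ∃ y : Fin (p + 1) → ℂ,
      ∑ i, ‖y i‖ ^ 2 = 1 ∧ x 0 = c * Real.cos α ∧ ∀ i, x (Fin.succ i) = c * (Real.sin α * y i) := by
  rw [Fin.sum_univ_succ] at hx
  have hx0 : ‖x 0‖ ≤ 1 := by
    have h1 : 0 ≤ ∑ i : Fin (p + 1), ‖x i.succ‖ ^ 2 := Finset.sum_nonneg fun _ _ => by positivity
    have h2 : ‖x 0‖ ^ 2 ≤ 1 := by linarith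
    exact (sq_le_one_iff₀ (norm_nonneg _)).1 h2
  obtain ⟨c, hc, hcx⟩ : ∃ c : ℂ, ‖c‖ = 1 ∧ x 0 = c * ‖x 0‖ := by
    refine ⟨Complex.exp (Complex.arg (x 0) * Complex.I), Complex.norm_exp_ofReal_mul_I _, ?_⟩
    rw [mul_comm]
    exact (Complex.norm_mul_exp_arg_mul_I (x 0)).symm
  have hcos : Real.cos (Real.arccos ‖x 0‖) = ‖x 0‖ :=
    Real.cos_arccos (by linarith [norm_nonneg (x 0)]) hx0
  set α := Real.arccos ‖x 0‖ with hα
  have hsin : Real.sin α ^ 2 = ∑ i : Fin (p + 1), ‖x i.succ‖ ^ 2 := by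
    have := Real.cos_sq_add_sin_sq α
    rw [hcos] at this
    linarith
  have hc0 : c ≠ 0 := by rintro rfl; simp at hc
  refine ⟨c, hc, α, ⟨Real.arccos_nonneg _, ?_⟩, ?_⟩
  · linarith [Real.arccos_le_pi ‖x 0‖, Real.pi_pos]
  -- if `sin α = 0`, the remaining coordinates vanish and any unit vector `y` does
  by_cases hs : Real.sin α = 0
  · refine ⟨Pi.single 0 1, ?_, by rw [hcos]; exact hcx, fun i => ?_⟩
    · rw [Finset.sum_eq_single 0] <;> simp +contextual
    · rw [hs, zero_pow two_ne_zero, eq_comm,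
        Finset.sum_eq_zero_iff_of_nonneg fun _ _ => by positivity] at hsin
      have := hsin i (Finset.mem_univ i)
      rw [hs]
      simpa using this
  · refine ⟨fun i => c⁻¹ * (Real.sin α : ℂ)⁻¹ * x i.succ, ?_, by rw [hcos]; exact hcx, fun i => ?_⟩
    · simp only [norm_mul, norm_inv, hc, inv_one, one_mul, mul_pow, ← Finset.mul_sum, ← hsin,
        Complex.norm_real, Real.norm_eq_abs, inv_pow, sq_abs]
      exact inv_mul_cancel₀ (pow_ne_zero 2 hs)
    · have hs' : (Real.sin α : ℂ) ≠ 0 := Complex.ofReal_ne_zero.2 hs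
      field_simp

lemma conjTranspose_mul_mul_self {q : ℕ} {A : Matrix (Fin p) (Fin q) ℂ}
    {B : Matrix (Fin q) (Fin m) ℂ} (hA : Aᴴ * A = 1) : (A * B)ᴴ * (A * B) = Bᴴ * B := by
  rw [Matrix.conjTranspose_mul, Matrix.mul_assoc, ← Matrix.mul_assoc Aᴴ, hA, Matrix.one_mul]

lemma conjTranspose_smul_mul_self {c : ℂ} (hc : ‖c‖ = 1) (A : Matrix (Fin p) (Fin m) ℂ) :
    (c • A)ᴴ * (c • A) = Aᴴ * A := by
  have : star c * c = 1 := by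
    rw [Complex.star_def, Complex.conj_mul', hc]; simp
  rw [Matrix.conjTranspose_smul, Matrix.smul_mul, Matrix.mul_smul, smul_smul, this, one_smul]

lemma norm_cos_add_sin_mul_I (β : ℝ) : ‖(Real.cos β : ℂ) + Real.sin β * Complex.I‖ = 1 := by
  rw [Complex.ofReal_cos, Complex.ofReal_sin]
  exact Complex.norm_cos_add_sin_mul_I β

/-- A family of unitary matrices, depending on `2 p` angles, which moves the first basis vector
to every unit vector of `ℂ ^ (p + 1)` up to a phase. -/
lemma exists_unitary_family_phase (p : ℕ) :
    ∃ L : (Fin (2 * p) → ℝ) → Matrix (Fin (p + 1)) (Fin (p + 1)) ℂ,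
      (∀ i j, IsTrigPoly fun θ => L θ i j) ∧ (∀ θ, (L θ)ᴴ * L θ = 1) ∧
      ∀ x : Fin (p + 1) → ℂ, ∑ i, ‖x i‖ ^ 2 = 1 →
        ∃ c : ℂ, ‖c‖ = 1 ∧ ∃ θ ∈ angleCube (2 * p), ∀ i, x i = c * L θ i 0 := by
  induction p with
  | zero =>
    refine ⟨fun _ => 1, fun i j => IsTrigPoly.const _, by simp, fun x hx => ?_⟩
    refine ⟨x 0, ?_, 0, fun i => i.elim0, fun i => ?_⟩
    · have hx' : ‖x 0‖ ^ 2 = 1 := by simpa using hx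
      exact (pow_eq_one_iff_of_nonneg (norm_nonneg _) two_ne_zero).1 hx'
    · rw [Fin.fin_one_eq_zero i]; simp
  | succ p ih =>
    obtain ⟨L, hL, hLu, hLs⟩ := ih
    -- `2 p` angles for `L`, then the phase `β` and the angle `α` of the rotation
    let res : (Fin (2 * (p + 1)) → ℝ) → Fin (2 * p) → ℝ := fun θ i => θ i.castSucc.castSucc
    let β : Fin (2 * (p + 1)) := (Fin.last (2 * p)).castSucc
    let α : Fin (2 * (p + 1)) := Fin.last (2 * p + 1)
    refine ⟨fun θ => oneSum (((Real.cos (θ β) : ℂ) + Real.sin (θ β) * Complex.I) • L (res θ)) *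
      rotation p (Real.cos (θ α)) (Real.sin (θ α)), ?_, fun θ => ?_, fun x hx => ?_⟩
    · exact IsTrigPoly.matrix_mul (IsTrigPoly.oneSum fun i j =>
        ((IsTrigPoly.cos β).add ((IsTrigPoly.sin β).mul (IsTrigPoly.const _))).mul
          ((hL i j).comp fun i => i.castSucc.castSucc))
        (IsTrigPoly.rotation (IsTrigPoly.cos α) (IsTrigPoly.sin α))
    · rw [conjTranspose_mul_mul_self, conjTranspose_rotation_mul_self]
      rw [conjTranspose_oneSum_mul_self, conjTranspose_smul_mul_self (norm_cos_add_sin_mul_I _),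
        hLu, oneSum_one]
    · obtain ⟨c, hc, a, ha, y, hy, hx0, hxs⟩ := exists_polar hx
      obtain ⟨c', hc', θ, hθ, hyL⟩ := hLs y hy
      obtain ⟨b, hb, hbc⟩ := exists_angle hc'
      refine ⟨c, hc, (Fin.snoc (Fin.snoc θ b : Fin (2 * p + 1) → ℝ) a : Fin (2 * p + 2) → ℝ),
        snoc_mem_angleCube (snoc_mem_angleCube hθ hb) ha, fun i => ?_⟩
      set Θ : Fin (2 * (p + 1)) → ℝ :=
        (Fin.snoc (Fin.snoc θ b : Fin (2 * p + 1) → ℝ) a : Fin (2 * p + 2) → ℝ) with hΘ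
      have hα : Θ α = a := Fin.snoc_last (α := fun _ => ℝ) _ _
      have hβ : Θ β = b := by
        rw [hΘ]
        refine (Fin.snoc_castSucc (α := fun _ => ℝ) _ _ _).trans ?_
        exact Fin.snoc_last (α := fun _ => ℝ) _ _
      have hres : res Θ = θ := by
        funext j
        rw [hΘ]
        refine (Fin.snoc_castSucc (α := fun _ => ℝ) _ _ _).trans ?_
        exact Fin.snoc_castSucc (α := fun _ => ℝ) _ _ _
      simp only [hα, hβ, hres, hbc]
      have hcol : ∀ X : Matrix (Fin (p + 1)) (Fin (p + 1)) ℂ, ∀ i,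
          (oneSum X * rotation p (Real.cos a) (Real.sin a)) i 0 =
            oneSum X i 0 * Real.cos a + oneSum X i (Fin.succ 0) * Real.sin a := by
        intro X i
        rw [Matrix.mul_apply, Fin.sum_univ_succ, Fin.sum_univ_succ, Finset.sum_eq_zero, add_zero]
        · rfl
        · intro k _; exact mul_zero _
      rw [hcol]
      refine Fin.cases ?_ (fun i => ?_) i
      · rw [hx0, oneSum_zero_zero, oneSum_zero_succ, one_mul, zero_mul, add_zero]
      · rw [hxs, oneSum_succ_zero, oneSum_succ_succ, hyL, Matrix.smul_apply, smul_eq_mul]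
        ring

/-- A family of unitary matrices, depending on `2 p + 1` angles, which moves the first basis vector
to every unit vector of `ℂ ^ (p + 1)`. -/
lemma exists_unitary_family (p : ℕ) :
    ∃ W : (Fin (2 * p + 1) → ℝ) → Matrix (Fin (p + 1)) (Fin (p + 1)) ℂ,
      (∀ i j, IsTrigPoly fun θ => W θ i j) ∧ (∀ θ, (W θ)ᴴ * W θ = 1) ∧
      ∀ x : Fin (p + 1) → ℂ, ∑ i, ‖x i‖ ^ 2 = 1 →
        ∃ θ ∈ angleCube (2 * p + 1), ∀ i, x i = W θ i 0 := by
  obtain ⟨L, hL, hLu, hLs⟩ := exists_unitary_family_phase p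
  refine ⟨fun θ => ((Real.cos (θ (Fin.last _)) : ℂ) + Real.sin (θ (Fin.last _)) * Complex.I) •
    L fun i => θ i.castSucc, fun i j => ?_, fun θ => ?_, fun x hx => ?_⟩
  · exact ((IsTrigPoly.cos _).add ((IsTrigPoly.sin _).mul (IsTrigPoly.const _))).mul
      ((hL i j).comp Fin.castSucc)
  · rw [conjTranspose_smul_mul_self (norm_cos_add_sin_mul_I _), hLu]
  · obtain ⟨c, hc, θ, hθ, hxL⟩ := hLs x hx
    obtain ⟨b, hb, hbc⟩ := exists_angle hc
    refine ⟨Fin.snoc θ b, snoc_mem_angleCube hθ hb, fun i => ?_⟩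
    simp only [Fin.snoc_last, Fin.snoc_castSucc, hbc]
    exact hxL i

/-! ### Parametrization of isometries -/

lemma append_mem_angleCube {M : ℕ} {θ : Fin N → ℝ} (hθ : θ ∈ angleCube N) {η : Fin M → ℝ}
    (hη : η ∈ angleCube M) : Fin.append θ η ∈ angleCube (N + M) := by
  intro i
  refine Fin.addCases (fun i => ?_) (fun i => ?_) i
  · simpa using hθ i
  · simpa using hη i

/-- Isometries from `ℂ ^ m` to `ℂ ^ p` are parametrized by `m (2 p - m)` angles: after a unitary
matrix sending the first basis vector to the first column, an isometry is `1 ⊕ U'` with `U'` an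
isometry from `ℂ ^ (m - 1)` to `ℂ ^ (p - 1)`. -/
lemma exists_isometry_family (m p N : ℕ) (hmp : m ≤ p) (hN : N = m * (2 * p - m)) :
    ∃ U : (Fin N → ℝ) → Matrix (Fin p) (Fin m) ℂ,
      (∀ i j, IsTrigPoly fun θ => U θ i j) ∧ (∀ θ, (U θ)ᴴ * U θ = 1) ∧
      ∀ X : Matrix (Fin p) (Fin m) ℂ, Xᴴ * X = 1 → ∃ θ ∈ angleCube N, U θ = X := by
  induction m generalizing p N with
  | zero =>
    rw [zero_mul] at hN
    subst hN
    exact ⟨fun _ => 0, fun i j => j.elim0, fun θ => Subsingleton.elim _ _,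
      fun X _ => ⟨0, fun i => i.elim0, by ext i j; exact j.elim0⟩⟩
  | succ m ih =>
    obtain ⟨p, rfl⟩ : ∃ q, p = q + 1 := ⟨p - 1, by omega⟩
    obtain ⟨U', hU', hUu', hUs'⟩ := ih p (m * (2 * p - m)) (by omega) rfl
    obtain ⟨W, hW, hWu, hWs⟩ := exists_unitary_family p
    have hN' : N = (2 * p + 1) + m * (2 * p - m) := by
      rw [hN]
      have h1 : 2 * (p + 1) - (m + 1) = (2 * p - m) + 1 := by omega
      have h2 : 2 * p - m + m = 2 * p := by omega
      rw [h1]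
      linear_combination h2
    clear hN
    subst hN'
    refine ⟨fun θ => W (fun i => θ (Fin.castAdd _ i)) * oneSum (U' fun i => θ (Fin.natAdd _ i)),
      ?_, fun θ => ?_, fun X hX => ?_⟩
    · exact IsTrigPoly.matrix_mul (fun i j => (hW i j).comp _)
        (IsTrigPoly.oneSum fun i j => (hU' i j).comp _)
    · rw [conjTranspose_mul_mul_self (hWu _), conjTranspose_oneSum_mul_self, hUu', oneSum_one]
    · have hcol : ∑ i, ‖X i 0‖ ^ 2 = 1 := by
        have := congrFun (congrFun hX 0) 0
        simp only [Matrix.mul_apply, Matrix.conjTranspose_apply, Matrix.one_apply_eq,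
          Complex.star_def, Complex.conj_mul'] at this
        exact_mod_cast this
      obtain ⟨θ, hθ, hXW⟩ := hWs (fun i => X i 0) hcol
      set Y := (W θ)ᴴ * X with hY
      have hWW : W θ * (W θ)ᴴ = 1 := mul_eq_one_comm.1 (hWu θ)
      have hYu : Yᴴ * Y = 1 := by
        rw [hY, conjTranspose_mul_mul_self (by rw [Matrix.conjTranspose_conjTranspose, hWW]), hX]
      have hY0 : ∀ i, Y i 0 = (1 : Matrix (Fin (p + 1)) (Fin (p + 1)) ℂ) i 0 := by
        intro i
        rw [← hWu θ, hY, Matrix.mul_apply, Matrix.mul_apply]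
        exact Finset.sum_congr rfl fun k _ => by rw [hXW k]
      have hYrow : ∀ j, Y 0 j = (1 : Matrix (Fin (m + 1)) (Fin (m + 1)) ℂ) 0 j := by
        intro j
        rw [← hYu, Matrix.mul_apply, Fin.sum_univ_succ, Finset.sum_eq_zero, add_zero,
          Matrix.conjTranspose_apply, hY0, Matrix.one_apply_eq, star_one, one_mul]
        intro k _
        rw [Matrix.conjTranspose_apply, hY0, Matrix.one_apply_ne (Fin.succ_ne_zero k), star_zero,
          zero_mul]
      set Z : Matrix (Fin p) (Fin m) ℂ := Matrix.of fun i j => Y i.succ j.succ with hZ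
      have hYZ : Y = oneSum Z := by
        ext i j
        refine Fin.cases ?_ (fun j => ?_) j
        · rw [hY0]
          refine Fin.cases ?_ (fun i => ?_) i
          · simp
          · rw [Matrix.one_apply_ne (Fin.succ_ne_zero i), oneSum_succ_zero]
        · refine Fin.cases ?_ (fun i => ?_) i
          · rw [hYrow, Matrix.one_apply_ne (Fin.succ_ne_zero j).symm, oneSum_zero_succ]
          · rfl
      have hZu : Zᴴ * Z = 1 := by
        apply oneSum_injective
        rw [← conjTranspose_oneSum_mul_self, ← hYZ, hYu, oneSum_one]
      obtain ⟨η, hη, hηZ⟩ := hUs' Z hZu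
      refine ⟨Fin.append θ η, append_mem_angleCube hθ hη, ?_⟩
      simp only [Fin.append_left, Fin.append_right]
      change W θ * oneSum (U' η) = X
      rw [hηZ, ← hYZ, hY, ← Matrix.mul_assoc, hWW, Matrix.one_mul]

lemma numAngles_eq {p m : ℕ} (hm : 1 ≤ m) (hmp : m ≤ p) (d : ℕ) :
    numAngles p m d = d * (2 * (p - 1)) + m * (2 * p - m) := by
  obtain ⟨m, rfl⟩ : ∃ q, m = q + 1 := ⟨m - 1, by omega⟩
  obtain ⟨k, rfl⟩ : ∃ k, p = m + 1 + k := ⟨p - (m + 1), by omega⟩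
  have h1 : 2 * (m + 1 + k) - (m + 1) - 1 = m + 2 * k := by omega
  have h2 : m + 1 + k - 1 = m + k := by omega
  have h3 : 2 * (m + 1 + k) - (m + 1) = m + 1 + 2 * k := by omega
  rw [numAngles, h1, h2, h3, Nat.add_sub_cancel]
  ring

/-- Families of `d` unit vectors, up to phases, together with an isometry are parametrized by
`numAngles p m d` angles. -/
lemma exists_angle_family {p m : ℕ} (hm : 1 ≤ m) (hmp : m ≤ p) (d : ℕ) :
    ∃ (v : Fin d → (Fin (numAngles p m d) → ℝ) → Fin p → ℂ)
      (U : (Fin (numAngles p m d) → ℝ) → Matrix (Fin p) (Fin m) ℂ),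
      (∀ j i, IsTrigPoly fun θ => v j θ i) ∧ (∀ i k, IsTrigPoly fun θ => U θ i k) ∧
      (∀ j θ, star (v j θ) ⬝ᵥ v j θ = 1) ∧ (∀ θ, (U θ)ᴴ * U θ = 1) ∧
      ∀ (w : Fin d → Fin p → ℂ) (X : Matrix (Fin p) (Fin m) ℂ), (∀ j, star (w j) ⬝ᵥ w j = 1) →
        Xᴴ * X = 1 → ∃ θ ∈ angleCube (numAngles p m d), U θ = X ∧
          ∀ j, ∃ c : ℂ, ‖c‖ = 1 ∧ w j = c • v j θ := by
  rw [numAngles_eq hm hmp]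
  obtain ⟨U, hU, hUu, hUs⟩ := exists_isometry_family m p _ hmp rfl
  obtain ⟨p, rfl⟩ : ∃ q, p = q + 1 := ⟨p - 1, by omega⟩
  obtain ⟨L, hL, hLu, hLs⟩ := exists_unitary_family_phase p
  rw [Nat.add_sub_cancel]
  refine ⟨fun j θ i => L (fun k => θ (Fin.castAdd _ (finProdFinEquiv (j, k)))) i 0,
    fun θ => U fun i => θ (Fin.natAdd _ i), fun j i => (hL i 0).comp _,
    fun i k => (hU i k).comp _, fun j θ => ?_, fun θ => hUu _, fun w X hw hX => ?_⟩
  · exact congrFun (congrFun (hLu fun k => θ (Fin.castAdd _ (finProdFinEquiv (j, k)))) 0) 0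
  · have hw' : ∀ j, ∑ i, ‖w j i‖ ^ 2 = 1 := by
      intro j
      have := hw j
      simp only [dotProduct, Pi.star_apply, Complex.star_def, Complex.conj_mul'] at this
      exact_mod_cast this
    choose c hc θ hθ hwL using fun j => hLs (w j) (hw' j)
    obtain ⟨η, hη, hηX⟩ := hUs X hX
    refine ⟨Fin.append (fun i => θ (finProdFinEquiv.symm i).1 (finProdFinEquiv.symm i).2) η,
      append_mem_angleCube (fun i => hθ _ _) hη, ?_, fun j => ⟨c j, hc j, ?_⟩⟩
    · simp only [Fin.append_right]
      exact hηX
    · funext i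
      simp only [Fin.append_left, Equiv.symm_apply_apply, Pi.smul_apply, smul_eq_mul]
      exact hwL j i

/-! ### Products indexed by `Fin d` -/

lemma map_filter_lt_finRange {α : Type*} {d : ℕ} (γ : ℕ) (v : Fin d → α) :
    ((List.finRange d).filter fun j : Fin d => (j : ℕ) < γ).map v = (List.ofFn v).take γ := by
  induction d generalizing γ with
  | zero => simp
  | succ d ih =>
    cases γ with
    | zero => simp
    | succ γ =>
      rw [List.finRange_succ, List.filter_cons_of_pos (by simp), List.map_cons, List.ofFn_succ,
        List.take_succ_cons, List.filter_map, List.map_map, ← ih γ fun j => v j.succ]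
      simp [Function.comp_def]

lemma map_filter_le_finRange {α : Type*} {d : ℕ} (γ : ℕ) (v : Fin d → α) :
    ((List.finRange d).filter fun j : Fin d => γ ≤ (j : ℕ)).map v = (List.ofFn v).drop γ := by
  induction d generalizing γ with
  | zero => simp
  | succ d ih =>
    cases γ with
    | zero =>
      simp only [Nat.zero_le, decide_true, List.filter_true, List.drop_zero]
      exact List.ofFn_eq_map.symm
    | succ γ =>
      rw [List.finRange_succ, List.filter_cons_of_neg (by simp), List.ofFn_succ,
        List.drop_succ_cons, List.filter_map, List.map_map, ← ih γ fun j => v j.succ]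
      simp [Function.comp_def]

lemma anticausalProd_eq {d : ℕ} (γ : Fin (d + 1)) (v : Fin d → Fin p → ℂ) :
    anticausalProd γ v = (((List.ofFn v).take γ).map (factor (T 1))).prod := by
  rw [anticausalProd, ← map_filter_lt_finRange, List.map_map]
  rfl

lemma causalProd_eq {d : ℕ} (γ : Fin (d + 1)) (v : Fin d → Fin p → ℂ) :
    causalProd γ v = (((List.ofFn v).drop γ).map (factor (T (-1)))).prod := by
  rw [causalProd, ← map_filter_le_finRange, List.map_map]
  rfl

lemma isoProduct_eq_listProduct {d : ℕ} (γ : Fin (d + 1)) (v : Fin d → Fin p → ℂ)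
    (U : Matrix (Fin p) (Fin m) ℂ) :
    isoProduct γ v U = listProduct ((List.ofFn v).take γ) ((List.ofFn v).drop γ) U := by
  rw [isoProduct, anticausalProd_eq, causalProd_eq, listProduct]

lemma transpose_listProd (k : ℤ) (l : List (Fin p → ℂ)) :
    (l.map (factor (T k))).prodᵀ = ((l.map star).reverse.map (factor (T k))).prod := by
  rw [Matrix.transpose_list_prod]
  simp only [List.map_map, List.map_reverse]
  congr 2
  refine List.map_congr_left fun v _ => ?_
  exact factor_transpose _ v

/-- Transposition turns co-isometric products into isometric ones; it reverses the order of the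
factors. -/
lemma transpose_coisoProduct {d : ℕ} (γ : Fin (d + 1)) (v : Fin d → Fin m → ℂ)
    (U : Matrix (Fin p) (Fin m) ℂ) :
    (coisoProduct γ v U)ᵀ = listProduct (((List.ofFn v).take γ).map star).reverse
      (((List.ofFn v).drop γ).map star).reverse Uᵀ := by
  rw [coisoProduct, anticausalProd_eq, causalProd_eq, listProduct, Matrix.transpose_mul,
    Matrix.transpose_mul, transpose_listProd, transpose_listProd, Matrix.mul_assoc]
  rfl

lemma isoProduct_congr {d : ℕ} (γ : Fin (d + 1)) {v w : Fin d → Fin p → ℂ}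
    (h : ∀ j, ∃ c : ℂ, ‖c‖ = 1 ∧ w j = c • v j) (U : Matrix (Fin p) (Fin m) ℂ) :
    isoProduct γ w U = isoProduct γ v U := by
  have hf : ∀ b j, factor b (w j) = factor b (v j) := by
    intro b j
    obtain ⟨c, hc, hw⟩ := h j
    rw [hw, factor_smul b hc]
  simp only [isoProduct, anticausalProd, causalProd, hf]

lemma coisoProduct_congr {d : ℕ} (γ : Fin (d + 1)) {v w : Fin d → Fin m → ℂ}
    (h : ∀ j, ∃ c : ℂ, ‖c‖ = 1 ∧ w j = c • v j) (U : Matrix (Fin p) (Fin m) ℂ) :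
    coisoProduct γ w U = coisoProduct γ v U := by
  have hf : ∀ b j, factor b (w j) = factor b (v j) := by
    intro b j
    obtain ⟨c, hc, hw⟩ := h j
    rw [hw, factor_smul b hc]
  simp only [coisoProduct, anticausalProd, causalProd, hf]

lemma inU_iff_adj_mul_self {F : FIR p m} (hmp : m ≤ p) : F.InU ↔ adj F * F = 1 := by
  rw [adj_mul_self_iff]
  refine ⟨fun h => h.1 hmp, fun h => ⟨fun _ => h, fun hpm => ?_⟩⟩
  obtain rfl := le_antisymm hmp hpm
  exact fun z hz => mul_eq_one_comm.1 (h z hz)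

lemma inU_transpose {F : FIR p m} (h : F.InU) : InU (Fᵀ : FIR m p) := by
  have he : ∀ z, eval (Fᵀ : FIR m p) z = (eval F z)ᵀ := fun z => rfl
  refine ⟨fun hpm z hz => ?_, fun hmp z hz => ?_⟩
  · rw [he, ← Matrix.transpose_one, ← h.2 hpm z hz, Matrix.transpose_mul]
    rfl
  · rw [he, ← Matrix.transpose_one, ← h.1 hmp z hz, Matrix.transpose_mul]
    rfl

lemma mcMillanDegree_listProduct_le (l₁ l₂ : List (Fin p → ℂ)) (U : Matrix (Fin p) (Fin m) ℂ) :
    (listProduct l₁ l₂ U).mcMillanDegree ≤ l₁.length + l₂.length := by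
  rw [mcMillanDegree_eq]
  have h1 := hankelRank_listProduct_le l₁ l₂ U
  have h2 := hankelRank_reflect_listProduct_le l₁ l₂ U
  omega

lemma mcMillanDegree_listProduct_nil {l : List (Fin p → ℂ)} {U : Matrix (Fin p) (Fin p) ℂ}
    (hl : ∀ v ∈ l, star v ⬝ᵥ v = 1) (hU : Uᴴ * U = 1) :
    (listProduct [] l U).mcMillanDegree = l.length := by
  rw [mcMillanDegree_eq, hankelRank_listProduct_nil hl hU,
    isCausal_iff_hankelRank.1 (isCausal_listProduct_nil l U), add_zero]

/-- An isometric FIR of McMillan degree `d` is the product of exactly `d` elementary factors and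
a constant isometry, with causal factors only if it is causal. -/
lemma exists_eq_listProduct_length {F : FIR p m} (hF : adj F * F = 1) :
    ∃ (l₁ l₂ : List (Fin p → ℂ)) (U : Matrix (Fin p) (Fin m) ℂ), (∀ v ∈ l₁, star v ⬝ᵥ v = 1) ∧
      (∀ v ∈ l₂, star v ⬝ᵥ v = 1) ∧ Uᴴ * U = 1 ∧ l₁.length + l₂.length = F.mcMillanDegree ∧
      (F.IsCausal → l₁ = []) ∧ F = listProduct l₁ l₂ U := by
  obtain ⟨l₁, l₂, U, h1, h2, h3, h4, h5, h6⟩ := exists_eq_listProduct hF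
  refine ⟨l₁, l₂, U, h1, h2, h3, le_antisymm ?_ ?_, fun hc => ?_, h6⟩
  · rw [mcMillanDegree_eq]; omega
  · conv_lhs => rw [h6]
    exact mcMillanDegree_listProduct_le l₁ l₂ U
  · rw [isCausal_iff_hankelRank.1 hc] at h4
    exact List.eq_nil_of_length_eq_zero (Nat.le_zero.1 h4)

/-- The two lists of factors as one family `v` indexed by `Fin d`, split at `γ`. -/
lemma exists_ofFn_eq_append {α : Type*} {d : ℕ} (l₁ l₂ : List α)
    (h : l₁.length + l₂.length = d) :
    ∃ (γ : Fin (d + 1)) (v : Fin d → α), (List.ofFn v).take γ = l₁ ∧ (List.ofFn v).drop γ = l₂ ∧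
      (l₁ = [] → γ = 0) ∧ ∀ j, v j ∈ l₁ ++ l₂ := by
  subst h
  have hlen : (l₁ ++ l₂).length = l₁.length + l₂.length := List.length_append
  have hof : List.ofFn (fun j : Fin (l₁.length + l₂.length) =>
      (l₁ ++ l₂).get (Fin.cast hlen.symm j)) = l₁ ++ l₂ := by
    rw [← List.ofFn_congr hlen (l₁ ++ l₂).get, List.ofFn_get]
  refine ⟨⟨l₁.length, by omega⟩, fun j => (l₁ ++ l₂).get (Fin.cast hlen.symm j), ?_, ?_, ?_,
    fun j => List.get_mem _ _⟩
  · rw [hof]; simp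
  · rw [hof]; simp
  · rintro rfl; rfl

lemma star_dotProduct_star_self {v : Fin p → ℂ} (hv : star v ⬝ᵥ v = 1) :
    star (star v) ⬝ᵥ star v = 1 := by
  rw [star_star, dotProduct_comm, hv]

lemma transpose_isometry_iff {U : Matrix (Fin p) (Fin m) ℂ} :
    (Uᵀ)ᴴ * Uᵀ = 1 ↔ U * Uᴴ = 1 := by
  have h : (Uᵀ)ᴴ * Uᵀ = (U * Uᴴ)ᵀ := by rw [Matrix.transpose_mul]; rfl
  rw [h]
  refine ⟨fun e => ?_, fun e => by rw [e, Matrix.transpose_one]⟩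
  rw [← Matrix.transpose_transpose (U * Uᴴ), e, Matrix.transpose_one]

theorem exists_isoProduct_parametrization (hm : 1 ≤ m) (hmp : m ≤ p) (d : ℕ) :
    ∃ (v : Fin d → (Fin (numAngles p m d) → ℝ) → Fin p → ℂ)
      (U : (Fin (numAngles p m d) → ℝ) → Matrix (Fin p) (Fin m) ℂ),
      (∀ j i, IsTrigPoly fun θ => v j θ i) ∧ (∀ i k, IsTrigPoly fun θ => U θ i k) ∧
      (∀ j θ, star (v j θ) ⬝ᵥ v j θ = 1) ∧ (∀ θ, (U θ)ᴴ * U θ = 1) ∧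
      IsParametrization (fun γ θ => isoProduct γ (fun j => v j θ) (U θ)) := by
  obtain ⟨v, U, hv, hU, hvu, hUu, hsurj⟩ := exists_angle_family hm hmp d
  have hunit : ∀ θ, ∀ w ∈ List.ofFn fun j => v j θ, star w ⬝ᵥ w = 1 := by
    intro θ w hw
    obtain ⟨j, rfl⟩ := (List.mem_ofFn' _ _).1 hw
    exact hvu j θ
  have hcover : ∀ F : FIR p m, F.InU → F.mcMillanDegree = d → ∃ γ : Fin (d + 1),
      (F.IsCausal → γ = 0) ∧
      ∃ θ ∈ angleCube (numAngles p m d), isoProduct γ (fun j => v j θ) (U θ) = F := by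
    intro F hF hd
    obtain ⟨l₁, l₂, X, h1, h2, h3, h4, h5, h6⟩ :=
      exists_eq_listProduct_length ((inU_iff_adj_mul_self hmp).1 hF)
    obtain ⟨γ, w, hw1, hw2, hγ, hw⟩ := exists_ofFn_eq_append l₁ l₂ (h4.trans hd)
    obtain ⟨θ, hθ, hUX, hwv⟩ := hsurj w X
      (fun j => (List.mem_append.1 (hw j)).elim (h1 _) (h2 _)) h3
    refine ⟨γ, fun hc => hγ (h5 hc), θ, hθ, ?_⟩
    rw [← isoProduct_congr γ hwv, hUX, isoProduct_eq_listProduct, hw1, hw2, ← h6]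
  refine ⟨v, U, hv, hU, hvu, hUu, fun γ θ => ⟨?_, ?_⟩, fun F hF hd => ?_, fun θ => ?_,
    fun F hF hd hc => ?_, fun hpm θ => ?_⟩
  · beta_reduce
    rw [isoProduct_eq_listProduct, inU_iff_adj_mul_self hmp]
    exact adj_mul_self_listProduct (fun w hw => hunit θ w (List.mem_of_mem_take hw))
      (fun w hw => hunit θ w (List.mem_of_mem_drop hw)) (hUu θ)
  · beta_reduce
    rw [isoProduct_eq_listProduct]
    refine (mcMillanDegree_listProduct_le _ _ _).trans (le_of_eq ?_)
    rw [← List.length_append, List.take_append_drop, List.length_ofFn]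
  · obtain ⟨γ, -, h⟩ := hcover F hF hd
    exact ⟨γ, h⟩
  · simp only [isoProduct_eq_listProduct]
    exact isCausal_listProduct_nil _ _
  · obtain ⟨γ, hγ, h⟩ := hcover F hF hd
    rwa [hγ hc] at h
  · subst hpm
    simp only [isoProduct_eq_listProduct]
    refine (mcMillanDegree_listProduct_nil (fun w hw => hunit θ w hw) (hUu θ)).trans ?_
    exact List.length_ofFn

theorem exists_coisoProduct_parametrization (hp : 1 ≤ p) (hpm : p ≤ m) (d : ℕ) :
    ∃ (v : Fin d → (Fin (numAngles m p d) → ℝ) → Fin m → ℂ)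
      (U : (Fin (numAngles m p d) → ℝ) → Matrix (Fin p) (Fin m) ℂ),
      (∀ j i, IsTrigPoly fun θ => v j θ i) ∧ (∀ i k, IsTrigPoly fun θ => U θ i k) ∧
      (∀ j θ, star (v j θ) ⬝ᵥ v j θ = 1) ∧ (∀ θ, U θ * (U θ)ᴴ = 1) ∧
      IsParametrization (fun γ θ => coisoProduct γ (fun j => v j θ) (U θ)) := by
  obtain ⟨v, U, hv, hU, hvu, hUu, hsurj⟩ := exists_angle_family hp hpm d
  have hunit : ∀ θ, ∀ w ∈ List.ofFn fun j => v j θ, star w ⬝ᵥ w = 1 := by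
    intro θ w hw
    obtain ⟨j, rfl⟩ := (List.mem_ofFn' _ _).1 hw
    exact hvu j θ
  have hunit' : ∀ {l : List (Fin m → ℂ)}, (∀ w ∈ l, star w ⬝ᵥ w = 1) →
      ∀ w ∈ (l.map star).reverse, star w ⬝ᵥ w = 1 := by
    intro l hl w hw
    obtain ⟨u, hu, rfl⟩ := List.mem_map.1 (List.mem_reverse.1 hw)
    exact star_dotProduct_star_self (hl u hu)
  have hcover : ∀ F : FIR p m, F.InU → F.mcMillanDegree = d → ∃ γ : Fin (d + 1),
      (F.IsCausal → γ = 0) ∧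
      ∃ θ ∈ angleCube (numAngles m p d), coisoProduct γ (fun j => v j θ) (U θ)ᵀ = F := by
    intro F hF hd
    obtain ⟨l₁, l₂, X, h1, h2, h3, h4, h5, h6⟩ :=
      exists_eq_listProduct_length ((inU_iff_adj_mul_self hpm).1 (inU_transpose hF))
    rw [mcMillanDegree_transpose, hd] at h4
    obtain ⟨γ, w, hw1, hw2, hγ, hw⟩ := exists_ofFn_eq_append (l₁.map star).reverse
      (l₂.map star).reverse (by simpa using h4)
    obtain ⟨θ, hθ, hUX, hwv⟩ := hsurj w X
      (fun j => (List.mem_append.1 (hw j)).elim (hunit' h1 _) (hunit' h2 _)) h3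
    -- transposing back reverses the lists and conjugates the vectors again
    refine ⟨γ, fun hc => hγ (by rw [h5 fun i j => hc j i]; rfl), θ, hθ, ?_⟩
    rw [← coisoProduct_congr γ hwv, hUX]
    apply Matrix.transpose_injective
    rw [transpose_coisoProduct, hw1, hw2, h6]
    simp [Function.comp_def]
  refine ⟨v, fun θ => (U θ)ᵀ, hv, fun i k => hU k i, hvu, fun θ => ?_, fun γ θ => ⟨?_, ?_⟩,
    fun F hF hd => ?_, fun θ => ?_, fun F hF hd hc => ?_, fun hpm θ => ?_⟩
  · rw [← transpose_isometry_iff, Matrix.transpose_transpose, hUu]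
  · beta_reduce
    rw [← Matrix.transpose_transpose (coisoProduct _ _ _)]
    refine inU_transpose ?_
    rw [transpose_coisoProduct, inU_iff_adj_mul_self hpm, Matrix.transpose_transpose]
    exact adj_mul_self_listProduct (hunit' fun w hw => hunit θ w (List.mem_of_mem_take hw))
      (hunit' fun w hw => hunit θ w (List.mem_of_mem_drop hw)) (hUu θ)
  · rw [← mcMillanDegree_transpose, transpose_coisoProduct]
    refine (mcMillanDegree_listProduct_le _ _ _).trans (le_of_eq ?_)
    rw [List.length_reverse, List.length_reverse, List.length_map, List.length_map,
      ← List.length_append, List.take_append_drop, List.length_ofFn]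
  · obtain ⟨γ, -, h⟩ := hcover F hF hd
    exact ⟨γ, h⟩
  · have h := isCausal_listProduct_nil ((List.ofFn fun j => v j θ).map star).reverse (U θ)
    have h2 := transpose_coisoProduct 0 (fun j => v j θ) (U θ)ᵀ
    intro i j k hk
    have h3 := congrFun (congrFun h2 j) i
    rw [Matrix.transpose_apply] at h3
    change (coisoProduct 0 (fun j => v j θ) (U θ)ᵀ i j).coeff k = 0
    rw [h3]
    exact h j i k hk
  · obtain ⟨γ, hγ, h⟩ := hcover F hF hd
    rwa [hγ hc] at h
  · subst hpm
    rw [← mcMillanDegree_transpose, transpose_coisoProduct, Matrix.transpose_transpose]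
    refine (mcMillanDegree_listProduct_nil
      (hunit' fun w hw => hunit θ w (List.mem_of_mem_drop hw)) (hUu θ)).trans ?_
    simp

/-! ### Causality and poles -/

lemma analyticAt_evalScalar (f : ℂ[T;T⁻¹]) {a : ℂ} (ha : a ≠ 0) :
    AnalyticAt ℂ (evalScalar f) a := by
  have h : evalScalar f = fun z => ∑ k ∈ f.coeff.support, f.coeff k * z ^ k := rfl
  rw [h]
  exact Finset.analyticAt_fun_sum _ fun k _ => analyticAt_const.mul (analyticAt_id.zpow ha)

lemma not_hasPoleAt (F : FIR p m) {a : ℂ} (ha : a ≠ 0) : ¬ F.HasPoleAt a := by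
  rintro ⟨i, j, h⟩
  exact not_le.2 h (analyticAt_evalScalar (F i j) ha).meromorphicOrderAt_nonneg

open Filter Topology in
/-- A Laurent polynomial has a pole at infinity as soon as a positive power occurs: with `K` the
largest exponent, `w ^ K f(1/w)` tends to the leading coefficient as `w` tends to zero. -/
lemma meromorphicOrderAt_evalScalar_inv_neg {f : ℂ[T;T⁻¹]} {k : ℤ} (hk : 0 < k)
    (hf : f.coeff k ≠ 0) : meromorphicOrderAt (fun w => evalScalar f w⁻¹) 0 < 0 := by
  have hne : f.coeff.support.Nonempty := ⟨k, Finsupp.mem_support_iff.2 hf⟩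
  set K := f.coeff.support.max' hne with hK
  have hKk : k ≤ K := Finset.le_max' _ _ (Finsupp.mem_support_iff.2 hf)
  have hfK : f.coeff K ≠ 0 := Finsupp.mem_support_iff.1 (Finset.max'_mem _ hne)
  set g : ℂ → ℂ := fun w => ∑ l ∈ f.coeff.support, f.coeff l * w ^ (K - l).toNat with hg
  have hga : AnalyticAt ℂ g 0 :=
    Finset.analyticAt_fun_sum _ fun l _ => analyticAt_const.mul (analyticAt_id.pow _)
  have hg0 : g 0 = f.coeff K := by
    rw [hg]
    refine (Finset.sum_eq_single K (fun l hl hlK => ?_) fun h => ?_).trans (by simp)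
    · have h1 : l ≤ K := Finset.le_max' _ _ hl
      have h2 : (K - l).toNat ≠ 0 := by omega
      simp [h2]
    · exact absurd (Finset.max'_mem _ hne) h
  have hmer : MeromorphicAt (fun w => evalScalar f w⁻¹) 0 := by
    have h : (fun w => evalScalar f w⁻¹) =
        fun w : ℂ => ∑ l ∈ f.coeff.support, f.coeff l * (w⁻¹) ^ l := rfl
    rw [h]
    fun_prop
  have horder : meromorphicOrderAt (fun w => evalScalar f w⁻¹) 0 = ((-K : ℤ) : WithTop ℤ) := by
    rw [meromorphicOrderAt_eq_int_iff hmer]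
    refine ⟨g, hga, by rw [hg0]; exact hfK, ?_⟩
    filter_upwards [self_mem_nhdsWithin] with w hw
    have hw0 : w ≠ 0 := hw
    change ∑ l ∈ f.coeff.support, f.coeff l * (w⁻¹) ^ l = _
    rw [hg, sub_zero, smul_eq_mul, Finset.mul_sum]
    refine Finset.sum_congr rfl fun l hl => ?_
    have h1 : l ≤ K := Finset.le_max' _ _ hl
    have h2 : ((K - l).toNat : ℤ) = K - l := Int.toNat_of_nonneg (by omega)
    rw [← zpow_natCast, h2, mul_left_comm, ← zpow_add₀ hw0, inv_zpow', neg_add_eq_sub]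
    congr 2
    ring
  rw [horder]
  exact_mod_cast (by omega : -K < 0)

lemma meromorphicOrderAt_evalScalar_inv_nonneg {f : ℂ[T;T⁻¹]}
    (hf : ∀ k : ℤ, 0 < k → f.coeff k = 0) :
    0 ≤ meromorphicOrderAt (fun w => evalScalar f w⁻¹) 0 := by
  have h : (fun w => evalScalar f w⁻¹) =
      fun w : ℂ => ∑ l ∈ f.coeff.support, f.coeff l * w ^ (-l).toNat := by
    funext w
    change ∑ l ∈ f.coeff.support, f.coeff l * (w⁻¹) ^ l = _
    refine Finset.sum_congr rfl fun l hl => ?_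
    have h1 : l ≤ 0 := by
      by_contra h0
      exact Finsupp.mem_support_iff.1 hl (hf l (not_le.1 h0))
    have h2 : ((-l).toNat : ℤ) = -l := Int.toNat_of_nonneg (by omega)
    rw [← zpow_natCast, h2, inv_zpow']
  rw [h]
  exact AnalyticAt.meromorphicOrderAt_nonneg
    (Finset.analyticAt_fun_sum _ fun l _ => analyticAt_const.mul (analyticAt_id.pow _))

theorem isCausal_iff_isLossless {F : FIR p m} (hF : F.InU) : F.IsCausal ↔ F.IsLossless := by
  constructor
  · intro h
    refine ⟨hF, fun a ha => ?_, ?_⟩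
    · by_contra hlt
      refine not_hasPoleAt F ?_ ha
      rintro rfl
      simp at hlt
    · rintro ⟨i, j, hij⟩
      exact not_le.2 hij (meromorphicOrderAt_evalScalar_inv_nonneg (h i j))
  · rintro ⟨-, -, h⟩ i j k hk
    by_contra h0
    exact h ⟨i, j, meromorphicOrderAt_evalScalar_inv_neg hk h0⟩

/-! ### The cube of angles -/

lemma angleCube_eq_pi (N : ℕ) :
    angleCube N = Set.univ.pi fun _ : Fin N => Set.Ico 0 (2 * Real.pi) := by
  ext θ; simp [angleCube]

lemma convex_angleCube (N : ℕ) : Convex ℝ (angleCube N) := by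
  rw [angleCube_eq_pi]
  exact convex_pi fun _ _ => convex_Ico _ _

lemma exists_closure_angleCube_eq_convexHull (N : ℕ) :
    ∃ S : Finset (Fin N → ℝ), closure (angleCube N) = convexHull ℝ (S : Set (Fin N → ℝ)) := by
  have h2π : 0 < 2 * Real.pi := by positivity
  refine ⟨Fintype.piFinset fun _ => {0, 2 * Real.pi}, ?_⟩
  rw [angleCube_eq_pi, closure_pi_set, Fintype.coe_piFinset]
  simp only [Finset.coe_insert, Finset.coe_singleton, closure_Ico h2π.ne]
  rw [convexHull_pi]
  simp only [convexHull_pair, segment_eq_Icc h2π.le]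

end FIR

end

theorem mainTheorem3 (p m d : ℕ) (hp : 1 ≤ p) (hm : 1 ≤ m) :
    (m ≤ p →
      ∃ (v : Fin d → (Fin (FIR.numAngles p m d) → ℝ) → Fin p → ℂ)
        (U : (Fin (FIR.numAngles p m d) → ℝ) → Matrix (Fin p) (Fin m) ℂ),
        (∀ j i, FIR.IsTrigPoly fun θ => v j θ i) ∧
        (∀ i k, FIR.IsTrigPoly fun θ => U θ i k) ∧
        (∀ j θ, star (v j θ) ⬝ᵥ v j θ = 1) ∧
        (∀ θ, (U θ)ᴴ * U θ = 1) ∧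
        FIR.IsParametrization (fun γ θ => FIR.isoProduct γ (fun j => v j θ) (U θ))) ∧
    (p ≤ m →
      ∃ (v : Fin d → (Fin (FIR.numAngles m p d) → ℝ) → Fin m → ℂ)
        (U : (Fin (FIR.numAngles m p d) → ℝ) → Matrix (Fin p) (Fin m) ℂ),
        (∀ j i, FIR.IsTrigPoly fun θ => v j θ i) ∧
        (∀ i k, FIR.IsTrigPoly fun θ => U θ i k) ∧
        (∀ j θ, star (v j θ) ⬝ᵥ v j θ = 1) ∧
        (∀ θ, U θ * (U θ)ᴴ = 1) ∧
        FIR.IsParametrization (fun γ θ => FIR.coisoProduct γ (fun j => v j θ) (U θ))) ∧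
    (∀ F : FIR p m, F.InU → (F.IsCausal ↔ F.IsLossless)) ∧
    (∀ N : ℕ, Convex ℝ (FIR.angleCube N) ∧
      ∃ S : Finset (Fin N → ℝ), closure (FIR.angleCube N) = convexHull ℝ (S : Set (Fin N → ℝ))) :=
  ⟨fun hmp => FIR.exists_isoProduct_parametrization hm hmp d,
    fun hpm => FIR.exists_coisoProduct_parametrization hp hpm d,
    fun _ hF => FIR.isCausal_iff_isLossless hF,
    fun N => ⟨FIR.convex_angleCube N, FIR.exists_closure_angleCube_eq_convexHull N⟩⟩
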